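/- **Definitions.** Let $a_1,\dots,a_n$ be integers. The rational tangle $(a_1,\dots,a_n)$ is built from two parallel vertical strands by reading the syllables from left to right, alternately twisting the two bottom endpoints $|a_{2k+1}|$ times and the two right endpoints $|a_{2k}|$ times (beginning with $|a_1|$ twists of the bottom endpoints), where the overstrand of each crossing has positive slope if $a_i>0$ and negative slope if $a_i<0$. Its numerator closure joins the two top endpoints to each other and the two bottom endpoints to each other; its denominator closure joins the two left endpoints to each other and the two right endpoints to each other. The shadow of a link diagram is obtained by forgetting, at every crossing, which strand is the overstrand. A link diagram is *splittable* if a finite sequence of planar isotopies and Reidemeister moves turns it into a diagram in which one or more, but not all, of the components lie inside some circle and all the other components lie outside of it. The *Linking-Unlinking Game* on the shadow of a two-component link is played by two players, the Linker and the Unlinker, who take turns; in each turn the player chooses an unresolved crossing and resolves it by choosing which of its two strands is the overstrand. The game ends when all crossings are resolved. The Unlinker wins if the resulting link diagram is splittable; otherwise the Linker wins. A player has a winning strategy if that player can move so as to win regardless of the moves of the opponent. **Theorem.** Let $S$ be the shadow of the numerator or the denominator closure of the rational tangle $(a_1,\dots,a_n)$, and suppose that this closure has exactly two components. 1. If $a_{2k+1}=0$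 for all $k$ with $1\le 2k+1\le n$, then the Unlinker wins the Linking-Unlinking Game on $S$: every play, whoever moves first and however both players move, ends with a win of the Unlinker. 2. If $a_{2k+1}\neq 0$ for at least one $k$ with $1\le 2k+1\le n$, and all of $a_1,\dots,a_n$ are even, then the second player has a winning strategy in the Linking-Unlinking Game on $S$, regardless of the role: the Linker has one when the Unlinker moves first, and the Unlinker has one when the Linker moves first. -/

import Mathlib

namespace LinkGame

/-! ## Plane diagrams

A plane diagram in general position with respect to the height function is cut by horizontal lines
into slices, each containing exactly one local maximum, local minimum or crossing, with vertical
strands to its left and to its right. A diagram is the list of its slices, read from top to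
bottom. A diagram of closed curves starts and ends with no strand at all. The type `C`
records the information kept at a crossing. -/

/-- The slope of the overstrand at a resolved crossing. -/
inductive Slope
  | pos
  | neg

/-- The other slope. -/
def Slope.opp : Slope → Slope
  | .pos => .neg
  | .neg => .pos

/-- The elementary pieces: `cap` is a local maximum, `cup` is a local minimum, and `cross c` is a
crossing of two strands, drawn as the letter X. -/
inductive Piece (C : Type)
  | cap
  | cup
  | cross (c : C)

/-- The number of strands entering a piece from above. -/
def Piece.dom {C : Type} : Piece C → ℕ
  | .cap => 0
  | .cup => 2
  | .cross _ => 2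

/-- The number of strands leaving a piece below. -/
def Piece.cod {C : Type} : Piece C → ℕ
  | .cap => 2
  | .cup => 0
  | .cross _ => 2

/-- Change the information at the crossings. -/
def Piece.map {C C' : Type} (f : C → C') : Piece C → Piece C'
  | .cap => .cap
  | .cup => .cup
  | .cross c => .cross (f c)

/-- A horizontal slice: a piece with `left` vertical strands to its left and `right` vertical
strands to its right. -/
structure Slice (C : Type) where
  left : ℕ
  piece : Piece C
  right : ℕ

/-- The number of strands entering a slice from above. -/
def Slice.dom {C : Type} (s : Slice C) : ℕ := s.left + s.piece.dom + s.right

/-- The number of strands leaving a slice below. -/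
def Slice.cod {C : Type} (s : Slice C) : ℕ := s.left + s.piece.cod + s.right

/-- Change the information at the crossings. -/
def Slice.map {C C' : Type} (f : C → C') (s : Slice C) : Slice C' :=
  ⟨s.left, s.piece.map f, s.right⟩

/-- A list of slices, read from top to bottom. -/
abbrev Word (C : Type) := List (Slice C)

/-- The slices of `w` fit together to a diagram with `m` endpoints at the top and `n` endpoints
at the bottom. -/
def IsTangle {C : Type} : ℕ → Word C → ℕ → Prop
  | m, [], n => m = n
  | m, s :: w, n => s.dom = m ∧ IsTangle s.cod w n

/-- Put `k` vertical strands to the left and `l` vertical strands to the right. -/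
def whisker {C : Type} (k l : ℕ) (w : Word C) : Word C :=
  w.map fun s => ⟨k + s.left, s.piece, s.right + l⟩

/-- A diagram of closed curves in the plane. -/
structure Diagram (C : Type) where
  word : Word C
  closed : IsTangle 0 word 0

theorem IsTangle.append {C : Type} {m n p : ℕ} {v w : Word C} (hv : IsTangle m v n)
    (hw : IsTangle n w p) : IsTangle m (v ++ w) p := by
  induction v generalizing m with
  | nil => cases hv; exact hw
  | cons s v ih => exact ⟨hv.1, ih hv.2⟩

theorem IsTangle.whisker {C : Type} (k l : ℕ) {m n : ℕ} {w : Word C} (hw : IsTangle m w n) :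
    IsTangle (k + m + l) (whisker k l w) (k + n + l) := by
  induction w generalizing m with
  | nil => cases hw; rfl
  | cons s w ih =>
    refine ⟨?_, ?_⟩
    · rw [← hw.1]; simp only [Slice.dom]; omega
    · have h := ih hw.2
      have e : k + s.cod + l = Slice.cod ⟨k + s.left, s.piece, s.right + l⟩ := by
        simp only [Slice.cod]; omega
      rw [e] at h
      exact h

theorem Slice.dom_map {C C' : Type} (f : C → C') (s : Slice C) : (s.map f).dom = s.dom := by
  obtain ⟨l, p, r⟩ := s
  cases p <;> rfl

theorem Slice.cod_map {C C' : Type} (f : C → C') (s : Slice C) : (s.map f).cod = s.cod := by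
  obtain ⟨l, p, r⟩ := s
  cases p <;> rfl

theorem IsTangle.map {C C' : Type} (f : C → C') {m n : ℕ} {w : Word C} (hw : IsTangle m w n) :
    IsTangle m (List.map (Slice.map f) w) n := by
  induction w generalizing m with
  | nil => exact hw
  | cons s w ih =>
    refine ⟨(s.dom_map f).trans hw.1, ?_⟩
    have h := ih hw.2
    rw [← s.cod_map f] at h
    exact h

/-- Change the information at the crossings. -/
def Diagram.map {C C' : Type} (f : C → C') (D : Diagram C) : Diagram C' :=
  ⟨List.map (Slice.map f) D.word, D.closed.map f⟩

/-- A link diagram: every crossing is resolved. -/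
abbrev LinkDiagram := Diagram Slope

/-- A link pseudodiagram: a crossing is either unresolved (`none`) or resolved. -/
abbrev Pseudodiagram := Diagram (Option Slope)

/-- A link diagram, seen as a pseudodiagram all of whose crossings are resolved. -/
def LinkDiagram.toPseudo (D : LinkDiagram) : Pseudodiagram := Diagram.map some D

/-- The shadow of a link diagram: all the crossings become unresolved. -/
def LinkDiagram.shadow (D : LinkDiagram) : Pseudodiagram := Diagram.map (fun _ => none) D

/-! ## Components -/

/-- The points in which the diagram meets the horizontal lines between the slices: `(j, p)` is the
`p`-th point, counted from the left and from `0`, on the line just above the `j`-th slice. -/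
def Diagram.IsPoint {C : Type} (D : Diagram C) (x : ℕ × ℕ) : Prop :=
  ∃ s, D.word[x.1]? = some s ∧ x.2 < s.dom

/-- Two points are joined by a strand inside one slice. At a crossing the strands go straight
on. -/
inductive Diagram.Joined {C : Type} (D : Diagram C) : ℕ × ℕ → ℕ × ℕ → Prop
  | left {j p : ℕ} {s : Slice C} (h : D.word[j]? = some s) (hp : p < s.left) :
      Joined D (j, p) (j + 1, p)
  | right {j p : ℕ} {s : Slice C} (h : D.word[j]? = some s) (hp : p < s.right) :
      Joined D (j, s.left + s.piece.dom + p) (j + 1, s.left + s.piece.cod + p)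
  | cap {j l r : ℕ} (h : D.word[j]? = some ⟨l, .cap, r⟩) : Joined D (j + 1, l) (j + 1, l + 1)
  | cup {j l r : ℕ} (h : D.word[j]? = some ⟨l, .cup, r⟩) : Joined D (j, l) (j, l + 1)
  | crossDown {j l r : ℕ} {c : C} (h : D.word[j]? = some ⟨l, .cross c, r⟩) :
      Joined D (j, l) (j + 1, l + 1)
  | crossUp {j l r : ℕ} {c : C} (h : D.word[j]? = some ⟨l, .cross c, r⟩) :
      Joined D (j, l + 1) (j + 1, l)

/-- The components of a diagram. -/
def Diagram.Component {C : Type} (D : Diagram C) : Type :=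
  Quot fun x y : {x : ℕ × ℕ // D.IsPoint x} => D.Joined x.1 y.1

/-- The number of components of a diagram. -/
noncomputable def Diagram.numComponents {C : Type} (D : Diagram C) : ℕ := Nat.card D.Component

/-! ## Equivalence of link diagrams -/

/-- The local moves. The first six are the elementary planar isotopies between diagrams in general
position with respect to the height: interchanging the heights of two distant pieces, cancelling a
maximum against a neighbouring minimum, and letting a crossing turn past a maximum or a minimum.
The other ones are the Reidemeister moves R1, R2 and R3; in R3 the only excluded slopes are the two
for which none of the three strands lies above the other two. -/
inductive LocalMove : Word Slope → Word Slope → Prop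
  | interchange (l m r : ℕ) (g h : Piece Slope) :
      LocalMove [⟨l, g, m + h.dom + r⟩, ⟨l + g.cod + m, h, r⟩]
        [⟨l + g.dom + m, h, r⟩, ⟨l, g, m + h.cod + r⟩]
  | zigzag (l r : ℕ) : LocalMove [⟨l, .cap, r + 1⟩, ⟨l + 1, .cup, r⟩] []
  | zagzig (l r : ℕ) : LocalMove [⟨l + 1, .cap, r⟩, ⟨l, .cup, r + 1⟩] []
  | turnCap (l r : ℕ) (s : Slope) :
      LocalMove [⟨l, .cap, r + 1⟩, ⟨l + 1, .cross s, r⟩]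
        [⟨l + 1, .cap, r⟩, ⟨l, .cross s.opp, r + 1⟩]
  | turnCup (l r : ℕ) (s : Slope) :
      LocalMove [⟨l + 1, .cross s, r⟩, ⟨l, .cup, r + 1⟩]
        [⟨l, .cross s.opp, r + 1⟩, ⟨l + 1, .cup, r⟩]
  | R1cap (l r : ℕ) (s : Slope) : LocalMove [⟨l, .cap, r⟩, ⟨l, .cross s, r⟩] [⟨l, .cap, r⟩]
  | R1cup (l r : ℕ) (s : Slope) : LocalMove [⟨l, .cross s, r⟩, ⟨l, .cup, r⟩] [⟨l, .cup, r⟩]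
  | R2 (l r : ℕ) (s : Slope) : LocalMove [⟨l, .cross s, r⟩, ⟨l, .cross s.opp, r⟩] []
  | R3 (l r : ℕ) (s t u : Slope) (h : s = t ∨ t = u) :
      LocalMove [⟨l, .cross s, r + 1⟩, ⟨l + 1, .cross t, r⟩, ⟨l, .cross u, r + 1⟩]
        [⟨l + 1, .cross u, r⟩, ⟨l, .cross t, r + 1⟩, ⟨l + 1, .cross s, r⟩]

/-- One local move, the rest of the diagram being unchanged. -/
def LinkDiagram.Step (D E : LinkDiagram) : Prop :=
  ∃ u v w w' : Word Slope, LocalMove w w' ∧ D.word = u ++ w ++ v ∧ E.word = u ++ w' ++ v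

/-- Equivalence of link diagrams: a finite sequence of Reidemeister moves and planar isotopies
and of their inverses. -/
def LinkDiagram.Equivalent : LinkDiagram → LinkDiagram → Prop :=
  Relation.EqvGen LinkDiagram.Step

/-- A split link diagram: a nonempty closed part `S` of it is drawn inside a rectangle with `k`
strands passing to its left and `l` strands passing to its right, and the remaining part, which is
not empty either, lies outside of the rectangle. -/
def LinkDiagram.IsSplit (D : LinkDiagram) : Prop :=
  ∃ (u v S : Word Slope) (k l : ℕ), IsTangle 0 S 0 ∧ S ≠ [] ∧ u ++ v ≠ [] ∧
    D.word = u ++ whisker k l S ++ v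

/-- A splittable link diagram. -/
def LinkDiagram.Splittable (D : LinkDiagram) : Prop :=
  ∃ E : LinkDiagram, D.Equivalent E ∧ E.IsSplit

/-! ## Rational tangles and their closures -/

/-- Twist the two bottom endpoints of a tangle with two endpoints at the top and two at the
bottom. -/
def twistBottom (s : Slope) (T : Word Slope) : Word Slope := T ++ [⟨0, .cross s, 0⟩]

/-- Twist the two right endpoints: put a crossing to the right of the tangle, and join its left
endpoints to the right endpoints of the tangle. -/
def twistRight (s : Slope) (T : Word Slope) : Word Slope :=
  [⟨1, .cap, 1⟩] ++ whisker 0 2 T ++ [⟨2, .cross s, 0⟩, ⟨1, .cup, 1⟩]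

/-- The slope of the overstrand in a syllable. -/
def syllableSlope (a : ℤ) : Slope := if 0 < a then .pos else .neg

/-- Read the syllables from left to right, alternating between twists of the bottom endpoints
(`true`) and twists of the right endpoints (`false`). -/
def addSyllables : Bool → Word Slope → List ℤ → Word Slope
  | _, T, [] => T
  | true, T, a :: as => addSyllables false ((twistBottom (syllableSlope a))^[a.natAbs] T) as
  | false, T, a :: as => addSyllables true ((twistRight (syllableSlope a))^[a.natAbs] T) as

/-- The rational tangle of a tangle word, built from two parallel vertical strands. -/
def rationalTangle (a : List ℤ) : Word Slope := addSyllables true [] a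

theorem isTangle_twistBottom (s : Slope) {T : Word Slope} (hT : IsTangle 2 T 2) :
    IsTangle 2 (twistBottom s T) 2 :=
  hT.append ⟨rfl, rfl⟩

theorem isTangle_twistRight (s : Slope) {T : Word Slope} (hT : IsTangle 2 T 2) :
    IsTangle 2 (twistRight s T) 2 :=
  IsTangle.append (n := 4) (IsTangle.append (n := 4) ⟨rfl, rfl⟩ (hT.whisker 0 2)) ⟨rfl, rfl, rfl⟩

theorem isTangle_iterate {f : Word Slope → Word Slope}
    (hf : ∀ T, IsTangle 2 T 2 → IsTangle 2 (f T) 2) (n : ℕ) {T : Word Slope}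
    (hT : IsTangle 2 T 2) : IsTangle 2 (f^[n] T) 2 := by
  induction n generalizing T with
  | zero => exact hT
  | succ n ih => exact ih (hf T hT)

theorem isTangle_addSyllables (b : Bool) {T : Word Slope} (hT : IsTangle 2 T 2) (a : List ℤ) :
    IsTangle 2 (addSyllables b T a) 2 := by
  induction a generalizing b T with
  | nil => cases b <;> exact hT
  | cons x a ih =>
    cases b
    · exact ih true (isTangle_iterate (fun _ h => isTangle_twistRight _ h) _ hT)
    · exact ih false (isTangle_iterate (fun _ h => isTangle_twistBottom _ h) _ hT)

theorem isTangle_rationalTangle (a : List ℤ) : IsTangle 2 (rationalTangle a) 2 :=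
  isTangle_addSyllables true (T := []) rfl a

/-- The two ways to close a tangle. -/
inductive Closure
  | numerator
  | denominator

/-- The numerator closure joins the two top endpoints and joins the two bottom endpoints. The
denominator closure joins the two left endpoints and joins the two right endpoints. -/
def closeWord : Closure → Word Slope → Word Slope
  | .numerator, T => [⟨0, .cap, 0⟩] ++ T ++ [⟨0, .cup, 0⟩]
  | .denominator, T =>
      [⟨0, .cap, 0⟩, ⟨2, .cap, 0⟩] ++ whisker 1 1 T ++ [⟨0, .cup, 2⟩, ⟨0, .cup, 0⟩]

theorem isTangle_closeWord (c : Closure) {T : Word Slope} (hT : IsTangle 2 T 2) :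
    IsTangle 0 (closeWord c T) 0 := by
  cases c
  · exact IsTangle.append (n := 2) (IsTangle.append (n := 2) ⟨rfl, rfl⟩ hT) ⟨rfl, rfl⟩
  · exact IsTangle.append (n := 4)
      (IsTangle.append (n := 4) ⟨rfl, rfl, rfl⟩ (hT.whisker 1 1)) ⟨rfl, rfl, rfl⟩

/-- The rational link diagram that is the given closure of the rational tangle. -/
def rationalLink (c : Closure) (a : List ℤ) : LinkDiagram :=
  ⟨closeWord c (rationalTangle a), isTangle_closeWord c (isTangle_rationalTangle a)⟩

/-! ## The Linking-Unlinking Game -/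

/-- A move of the game: resolve one unresolved crossing, in one of the two ways. -/
def Move (P Q : Pseudodiagram) : Prop :=
  ∃ (u v : Word (Option Slope)) (l r : ℕ) (s : Slope),
    P.word = u ++ [⟨l, .cross none, r⟩] ++ v ∧ Q.word = u ++ [⟨l, .cross (some s), r⟩] ++ v

/-- The game is over: no move is possible. -/
def IsOver (P : Pseudodiagram) : Prop := ∀ Q, ¬ Move P Q

/-- The two roles. -/
inductive Player
  | linker
  | unlinker

/-- The opponent. -/
def Player.other : Player → Player
  | .linker => .unlinker
  | .unlinker => .linker

/-- Who wins when the game ends with the link diagram `D`. -/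
def Player.WinsDiagram : Player → LinkDiagram → Prop
  | .linker, D => ¬ D.Splittable
  | .unlinker, D => D.Splittable

/-- The final position `P` is a link diagram that makes the player `p` the winner. -/
def Player.WinsAt (p : Player) (P : Pseudodiagram) : Prop :=
  ∃ D : LinkDiagram, D.toPseudo = P ∧ p.WinsDiagram D

/-- The positions that occur, with the player whose turn it is, in the plays that start at `P₀`
with a move of `starter`, in which `p` always moves according to the strategy `σ` and the opponent
moves arbitrarily. -/
inductive Play (p : Player) (σ : Pseudodiagram → Pseudodiagram) (starter : Player)
    (P₀ : Pseudodiagram) : Player → Pseudodiagram → Prop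
  | start : Play p σ starter P₀ starter P₀
  | own {P : Pseudodiagram} (h : Play p σ starter P₀ p P) (hm : Move P (σ P)) :
      Play p σ starter P₀ p.other (σ P)
  | opponent {P Q : Pseudodiagram} (h : Play p σ starter P₀ p.other P) (hm : Move P Q) :
      Play p σ starter P₀ p Q

/-- The player `p` has a winning strategy in the game that starts at `P₀` with a move of
`starter`: a rule that gives a legal move in each position that is not over, and with which `p` wins
every play. -/
def HasWinningStrategy (p starter : Player) (P₀ : Pseudodiagram) : Prop :=
  ∃ σ : Pseudodiagram → Pseudodiagram, (∀ P, ¬ IsOver P → Move P (σ P)) ∧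
    ∀ (q : Player) (P : Pseudodiagram), Play p σ starter P₀ q P → IsOver P → p.WinsAt P

/-- The second player has a winning strategy, in whichever role. -/
def SecondPlayerWins (P₀ : Pseudodiagram) : Prop :=
  ∀ p : Player, HasWinningStrategy p p.other P₀

/-- The player `p` wins every play that starts at `P₀`, whoever starts and however both players
move. -/
def AlwaysWins (p : Player) (P₀ : Pseudodiagram) : Prop :=
  ∀ P, Relation.ReflTransGen Move P₀ P → IsOver P → p.WinsAt P

end LinkGame

namespace LinkGame

/-! ## Two-coloured diagrams and the linking number modulo two

A colouring assigns a colour to each point of each horizontal line of a diagram; the colours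
of one line are the values of a function `ℕ → Bool`, whose values beyond the last strand are
carried along unchanged. -/

/-! The obstruction to splitting is the linking number modulo two. Colour the strands of a diagram
with two colours, constantly along components, and count modulo two the crossings at which `true`
lies over `false`. Reidemeister moves and planar isotopies transport such colourings and keep the
count (`LocalMove.coloured`). A split diagram has a colouring with both colours and no mixed
crossing, so a diagram in which every colouring with both colours has odd count is not splittable
(`LinkDiagram.OddlyLinked.not_splittable`).

If all bottom syllables are even, bottom twists come in pairs, and the two strands of the tangle run
from top left to bottom left and from top right to bottom right (`IsVertical`). The numerator
closure then joins them into a single component, so a two-component closure is the denominator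
closure, whose components are the two strands. Right twists are self-crossings. A pair of bottom
twists contributes to the linking number exactly when its slopes agree; hence reversing any one
bottom crossing changes the parity.

Without bottom twists the tangle untwists from the inside outwards, whatever the slopes, and two
disjoint circles remain. If all syllables are even, the crossings form consecutive pairs of the same
kind. As second player, the Unlinker answers inside the pair with the opposite slope: bottom pairs
cancel by R2, and right twists come undone anyway (`reduces_foldl_cancellingTwists`). The Linker
answers with a crossing of the same kind, bottom or right; by parity the Linker resolves the last
bottom crossing and chooses its slope to make the linking number odd (`IsVertical.foldl`,
`IsVertical.oddlyLinked`). -/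

/-- Insert two strands of colour `x` at position `l`. -/
def insertPair (l : ℕ) (x : Bool) (f : ℕ → Bool) : ℕ → Bool :=
  fun i => if i < l then f i else if i < l + 2 then x else f (i - 2)

/-- Remove the two strands at the positions `l` and `l + 1`. -/
def deletePair (l : ℕ) (f : ℕ → Bool) : ℕ → Bool :=
  fun i => if i < l then f i else f (i + 2)

/-- Exchange the two strands at the positions `l` and `l + 1`. -/
def swapPair (l : ℕ) (f : ℕ → Bool) : ℕ → Bool :=
  fun i => if i = l then f (l + 1) else if i = l + 1 then f l else f i

/-- The contribution of a crossing with incoming colours `x` and `y`: it counts if a strand of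
colour `true` lies over a strand of colour `false`. -/
def overWeight : Slope → Bool → Bool → ZMod 2
  | .pos, false, true => 1
  | .neg, true, false => 1
  | _, _, _ => 0

/-- `Coloured f w g p S`: the word `w` has a colouring with the colours `f` at the top and `g` at the
bottom, in which the number of crossings of `true` over `false` is `p` modulo two, and `S` is the
set of the colours of the maxima. -/
def Coloured (f : ℕ → Bool) : Word Slope → (ℕ → Bool) → ZMod 2 → Set Bool → Prop
  | [], g, p, S => g = f ∧ p = 0 ∧ S = ∅
  | ⟨l, .cap, _⟩ :: w, g, p, S =>
      ∃ x S', Coloured (insertPair l x f) w g p S' ∧ S = insert x S'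
  | ⟨l, .cup, _⟩ :: w, g, p, S => f l = f (l + 1) ∧ Coloured (deletePair l f) w g p S
  | ⟨l, .cross s, _⟩ :: w, g, p, S =>
      ∃ q, Coloured (swapPair l f) w g q S ∧ p = overWeight s (f l) (f (l + 1)) + q

theorem coloured_append {f g : ℕ → Bool} {u v : Word Slope} {p : ZMod 2} {S : Set Bool} :
    Coloured f (u ++ v) g p S ↔ ∃ h p₁ p₂ S₁ S₂, Coloured f u h p₁ S₁ ∧ Coloured h v g p₂ S₂ ∧
      p = p₁ + p₂ ∧ S = S₁ ∪ S₂ := by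
  induction u generalizing f p S with
  | nil =>
    constructor
    · intro h
      exact ⟨f, 0, p, ∅, S, ⟨rfl, rfl, rfl⟩, h, by simp, by simp⟩
    · rintro ⟨h, p₁, p₂, S₁, S₂, ⟨rfl, rfl, rfl⟩, h2, rfl, rfl⟩
      simpa using h2
  | cons s u ih =>
    obtain ⟨l, c | c | c, r⟩ := s
    · simp only [List.cons_append, Coloured, ih]
      constructor
      · rintro ⟨x, S', ⟨h, p₁, p₂, S₁, S₂, h1, h2, rfl, rfl⟩, rfl⟩
        exact ⟨h, p₁, p₂, _, S₂, ⟨x, S₁, h1, rfl⟩, h2, rfl, by rw [Set.insert_union]⟩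
      · rintro ⟨h, p₁, p₂, S₁, S₂, ⟨x, S', h1, rfl⟩, h2, rfl, rfl⟩
        exact ⟨x, _, ⟨h, p₁, p₂, S', S₂, h1, h2, rfl, rfl⟩, by rw [Set.insert_union]⟩
    · simp only [List.cons_append, Coloured, ih]
      constructor
      · rintro ⟨hc, h, p₁, p₂, S₁, S₂, h1, h2, rfl, rfl⟩
        exact ⟨h, p₁, p₂, _, S₂, ⟨hc, h1⟩, h2, rfl, rfl⟩
      · rintro ⟨h, p₁, p₂, S₁, S₂, ⟨hc, h1⟩, h2, rfl, rfl⟩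
        exact ⟨hc, h, p₁, p₂, S₁, S₂, h1, h2, rfl, rfl⟩
    · simp only [List.cons_append, Coloured, ih]
      constructor
      · rintro ⟨q, ⟨h, p₁, p₂, S₁, S₂, h1, h2, rfl, rfl⟩, rfl⟩
        exact ⟨h, _, p₂, S₁, S₂, ⟨p₁, h1, rfl⟩, h2, by rw [add_assoc], rfl⟩
      · rintro ⟨h, p₁, p₂, S₁, S₂, ⟨q, h1, rfl⟩, h2, rfl, rfl⟩
        exact ⟨_, ⟨h, q, p₂, S₁, S₂, h1, h2, rfl, rfl⟩, by rw [add_assoc]⟩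

theorem isTangle_append {C : Type} {m n : ℕ} {v w : Word C} :
    IsTangle m (v ++ w) n ↔ ∃ k, IsTangle m v k ∧ IsTangle k w n := by
  refine ⟨fun h => ?_, fun ⟨k, hv, hw⟩ => hv.append hw⟩
  induction v generalizing m with
  | nil => exact ⟨m, rfl, h⟩
  | cons s v ih =>
    obtain ⟨k, h1, h2⟩ := ih h.2
    exact ⟨k, ⟨h.1, h1⟩, h2⟩

/-- Each colour of the bottom line is a colour of the top line or of a maximum. -/
theorem Coloured.bottom_mem {f g : ℕ → Bool} {w : Word Slope} {p : ZMod 2} {S : Set Bool}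
    {m n : ℕ} (hw : IsTangle m w n) (h : Coloured f w g p S) {i : ℕ} (hi : i < n) :
    g i ∈ S ∪ f '' Set.Iio m := by
  induction w generalizing f p S m with
  | nil =>
    obtain ⟨rfl, -, -⟩ := h
    cases hw
    exact Or.inr ⟨i, hi, rfl⟩
  | cons s w ih =>
    obtain ⟨l, c | c | c, r⟩ := s
    · obtain ⟨rfl, hw⟩ := hw
      obtain ⟨x, S', h, rfl⟩ := h
      rcases ih hw h with h | ⟨j, hj, hj'⟩
      · exact Or.inl (Or.inr h)
      · rw [← hj']
        simp only [Set.mem_Iio, Slice.cod, Slice.dom, Piece.cod, Piece.dom] at hj ⊢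
        unfold insertPair
        split_ifs with h1 h2
        · exact Or.inr ⟨j, by simp only [Set.mem_Iio]; omega, rfl⟩
        · exact Or.inl (Or.inl rfl)
        · exact Or.inr ⟨j - 2, by simp only [Set.mem_Iio]; omega, rfl⟩
    · obtain ⟨rfl, hw⟩ := hw
      obtain ⟨-, h⟩ := h
      rcases ih hw h with h | ⟨j, hj, hj'⟩
      · exact Or.inl h
      · rw [← hj']
        simp only [Set.mem_Iio, Slice.cod, Slice.dom, Piece.cod, Piece.dom] at hj ⊢
        unfold deletePair
        split_ifs with h1
        · exact Or.inr ⟨j, by simp only [Set.mem_Iio]; omega, rfl⟩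
        · exact Or.inr ⟨j + 2, by simp only [Set.mem_Iio]; omega, rfl⟩
    · obtain ⟨rfl, hw⟩ := hw
      obtain ⟨q, h, rfl⟩ := h
      rcases ih hw h with h | ⟨j, hj, hj'⟩
      · exact Or.inl h
      · rw [← hj']
        simp only [Set.mem_Iio, Slice.cod, Slice.dom, Piece.cod, Piece.dom] at hj ⊢
        unfold swapPair
        split_ifs with h1 h2
        · exact Or.inr ⟨l + 1, by simp only [Set.mem_Iio]; omega, rfl⟩
        · exact Or.inr ⟨l, by simp only [Set.mem_Iio]; omega, rfl⟩
        · exact Or.inr ⟨j, by simp only [Set.mem_Iio]; omega, rfl⟩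

theorem insertPair_of_lt {l i : ℕ} {x : Bool} {f : ℕ → Bool} (h : i < l) :
    insertPair l x f i = f i := by simp [insertPair, h]

theorem insertPair_of_mem {l i : ℕ} {x : Bool} {f : ℕ → Bool} (h : l ≤ i) (h' : i < l + 2) :
    insertPair l x f i = x := by simp [insertPair, h', h.not_gt]

theorem insertPair_add {l i : ℕ} {x : Bool} {f : ℕ → Bool} (h : l ≤ i) :
    insertPair l x f (i + 2) = f i := by
  simp only [insertPair]
  rw [if_neg (by omega), if_neg (by omega)]
  rfl

theorem deletePair_of_lt {l i : ℕ} {f : ℕ → Bool} (h : i < l) :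
    deletePair l f i = f i := by simp [deletePair, h]

theorem deletePair_of_le {l i : ℕ} {f : ℕ → Bool} (h : l ≤ i) :
    deletePair l f i = f (i + 2) := by simp [deletePair, h.not_gt]

theorem swapPair_left (l : ℕ) (f : ℕ → Bool) : swapPair l f l = f (l + 1) := by simp [swapPair]

theorem swapPair_right (l : ℕ) (f : ℕ → Bool) : swapPair l f (l + 1) = f l := by simp [swapPair]

theorem swapPair_of_ne {l i : ℕ} {f : ℕ → Bool} (h : i ≠ l) (h' : i ≠ l + 1) :
    swapPair l f i = f i := by simp [swapPair, h, h']

theorem swapPair_eq_self {l : ℕ} {f : ℕ → Bool} (h : f l = f (l + 1)) : swapPair l f = f := by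
  funext i
  unfold swapPair
  split_ifs with h1 h2
  · rw [h1, h]
  · rw [h2, h]
  · rfl

theorem swapPair_swapPair (l : ℕ) (f : ℕ → Bool) : swapPair l (swapPair l f) = f := by
  funext i
  unfold swapPair
  split_ifs <;> first | omega | (congr 1 <;> omega)

theorem deletePair_insertPair (l : ℕ) (x : Bool) (f : ℕ → Bool) :
    deletePair l (insertPair l x f) = f := by
  funext i
  unfold deletePair insertPair
  split_ifs <;> first | rfl | omega

theorem overWeight_self (s : Slope) (x : Bool) : overWeight s x x = 0 := by
  cases s <;> cases x <;> rfl

theorem overWeight_opp (s : Slope) (x y : Bool) : overWeight s.opp x y = overWeight s y x := by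
  cases s <;> cases x <;> cases y <;> rfl

theorem Slope.opp_opp (s : Slope) : s.opp.opp = s := by cases s <;> rfl

theorem insertPair_insertPair (l m : ℕ) (x y : Bool) (f : ℕ → Bool) :
    insertPair (l + 2 + m) y (insertPair l x f) = insertPair l x (insertPair (l + m) y f) := by
  funext i
  simp only [insertPair]
  split_ifs <;> first | omega | rfl

theorem deletePair_insertPair_far (l m : ℕ) (x : Bool) (f : ℕ → Bool) :
    deletePair (l + 2 + m) (insertPair l x f) = insertPair l x (deletePair (l + m) f) := by
  funext i
  simp only [insertPair, deletePair]
  split_ifs <;> first | omega | rfl | (congr 1; omega)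

theorem swapPair_insertPair_far (l m : ℕ) (x : Bool) (f : ℕ → Bool) :
    swapPair (l + 2 + m) (insertPair l x f) = insertPair l x (swapPair (l + m) f) := by
  funext i
  simp only [insertPair, swapPair]
  split_ifs <;> first | omega | rfl | (congr 1; omega)

theorem deletePair_insertPair_add (l m : ℕ) (x : Bool) (f : ℕ → Bool) :
    deletePair l (insertPair (l + 2 + m) x f) = insertPair (l + m) x (deletePair l f) := by
  funext i
  simp only [insertPair, deletePair]
  split_ifs <;> first | omega | rfl | (congr 1; omega)

theorem deletePair_deletePair (l m : ℕ) (f : ℕ → Bool) :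
    deletePair (l + m) (deletePair l f) = deletePair l (deletePair (l + 2 + m) f) := by
  funext i
  simp only [deletePair]
  split_ifs <;> first | omega | rfl

theorem swapPair_deletePair_far (l m : ℕ) (f : ℕ → Bool) :
    swapPair (l + m) (deletePair l f) = deletePair l (swapPair (l + 2 + m) f) := by
  funext i
  simp only [swapPair, deletePair]
  split_ifs <;> first | omega | rfl | (congr 1; omega)

theorem swapPair_insertPair_add (l m : ℕ) (x : Bool) (f : ℕ → Bool) :
    swapPair l (insertPair (l + 2 + m) x f) = insertPair (l + 2 + m) x (swapPair l f) := by
  funext i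
  simp only [insertPair, swapPair]
  split_ifs <;> first | omega | rfl

theorem deletePair_swapPair_far (l m : ℕ) (f : ℕ → Bool) :
    deletePair (l + 2 + m) (swapPair l f) = swapPair l (deletePair (l + 2 + m) f) := by
  funext i
  simp only [deletePair, swapPair]
  split_ifs <;> first | omega | rfl

theorem swapPair_swapPair_far (l m : ℕ) (f : ℕ → Bool) :
    swapPair (l + 2 + m) (swapPair l f) = swapPair l (swapPair (l + 2 + m) f) := by
  funext i
  simp only [swapPair]
  split_ifs <;> first | omega | rfl

theorem deletePair_succ_insertPair (l : ℕ) {x : Bool} {f : ℕ → Bool} (h : f l = x) :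
    deletePair (l + 1) (insertPair l x f) = f := by
  funext i
  simp only [deletePair, insertPair]
  split_ifs <;> first | omega | rfl | (rw [← h]; congr 1; omega)

theorem deletePair_insertPair_succ (l : ℕ) {x : Bool} {f : ℕ → Bool} (h : f l = x) :
    deletePair l (insertPair (l + 1) x f) = f := by
  funext i
  simp only [deletePair, insertPair]
  split_ifs <;> first | omega | rfl | (rw [← h]; congr 1; omega)

theorem swapPair_succ_insertPair (l : ℕ) (x : Bool) (f : ℕ → Bool) :
    swapPair (l + 1) (insertPair l x f) = swapPair l (insertPair (l + 1) x f) := by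
  funext i
  simp only [swapPair, insertPair]
  split_ifs <;> first | omega | rfl

theorem deletePair_swapPair_succ (l : ℕ) (f : ℕ → Bool) :
    deletePair l (swapPair (l + 1) f) = deletePair (l + 1) (swapPair l f) := by
  funext i
  simp only [swapPair, deletePair]
  split_ifs <;> first | omega | rfl

theorem swapPair_braid (l : ℕ) (f : ℕ → Bool) :
    swapPair l (swapPair (l + 1) (swapPair l f)) =
      swapPair (l + 1) (swapPair l (swapPair (l + 1) f)) := by
  funext i
  simp only [swapPair]
  split_ifs <;> first | omega | rfl

theorem LocalMove.isTangle {w w' : Word Slope} (h : LocalMove w w') {m n : ℕ}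
    (hw : IsTangle m w n) : IsTangle m w' n := by
  cases h with
  | interchange l m r g h =>
    simp only [IsTangle, Slice.dom, Slice.cod] at hw ⊢
    omega
  | _ =>
    simp only [IsTangle, Slice.dom, Slice.cod, Piece.dom, Piece.cod] at hw ⊢
    omega

/-- A local move transports colourings in both directions, preserving the weight and the set of
colours. -/
theorem LocalMove.coloured {w w' : Word Slope} (hww : LocalMove w w') {m n : ℕ}
    (hw : IsTangle m w n) {f g : ℕ → Bool} {p : ZMod 2} :
    (∀ S, Coloured f w g p S →
      ∃ S', Coloured f w' g p S' ∧ S' ∪ f '' Set.Iio m = S ∪ f '' Set.Iio m) ∧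
    (∀ S, Coloured f w' g p S →
      ∃ S', Coloured f w g p S' ∧ S' ∪ f '' Set.Iio m = S ∪ f '' Set.Iio m) := by
  have key : (∀ S, Coloured f w g p S ↔ Coloured f w' g p S) →
    (∀ S, Coloured f w g p S →
      ∃ S', Coloured f w' g p S' ∧ S' ∪ f '' Set.Iio m = S ∪ f '' Set.Iio m) ∧
    (∀ S, Coloured f w' g p S →
      ∃ S', Coloured f w g p S' ∧ S' ∪ f '' Set.Iio m = S ∪ f '' Set.Iio m) :=
    fun h => ⟨fun S hS => ⟨S, (h S).1 hS, rfl⟩, fun S hS => ⟨S, (h S).2 hS, rfl⟩⟩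
  cases hww with
  | interchange l k r a b =>
    apply key
    intro S
    have e1 : ∀ (x : Bool) (f : ℕ → Bool), insertPair l x f (l + 2 + k) = f (l + k) :=
      fun x f => by rw [show l + 2 + k = l + k + 2 by ring, insertPair_add (by omega)]
    have e2 : ∀ (x : Bool) (f : ℕ → Bool), insertPair l x f (l + 2 + k + 1) = f (l + k + 1) :=
      fun x f => by rw [show l + 2 + k + 1 = l + k + 1 + 2 by ring, insertPair_add (by omega)]
    have e3 : ∀ (f : ℕ → Bool), deletePair l f (l + k) = f (l + 2 + k) :=
      fun f => by rw [deletePair_of_le (by omega), show l + 2 + k = l + k + 2 by ring]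
    have e4 : ∀ (f : ℕ → Bool), deletePair l f (l + k + 1) = f (l + 2 + k + 1) :=
      fun f => by rw [deletePair_of_le (by omega), show l + 2 + k + 1 = l + k + 1 + 2 by ring]
    have e5 : ∀ (f : ℕ → Bool), swapPair l f (l + 2 + k) = f (l + 2 + k) :=
      fun f => swapPair_of_ne (by omega) (by omega)
    have e6 : ∀ (f : ℕ → Bool), swapPair l f (l + 2 + k + 1) = f (l + 2 + k + 1) :=
      fun f => swapPair_of_ne (by omega) (by omega)
    have e7 : ∀ (x : Bool) (f : ℕ → Bool), insertPair (l + 2 + k) x f l = f l :=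
      fun x f => insertPair_of_lt (by omega)
    have e8 : ∀ (x : Bool) (f : ℕ → Bool), insertPair (l + 2 + k) x f (l + 1) = f (l + 1) :=
      fun x f => insertPair_of_lt (by omega)
    have e9 : ∀ (f : ℕ → Bool), deletePair (l + 2 + k) f l = f l :=
      fun f => deletePair_of_lt (by omega)
    have e10 : ∀ (f : ℕ → Bool), deletePair (l + 2 + k) f (l + 1) = f (l + 1) :=
      fun f => deletePair_of_lt (by omega)
    have e11 : ∀ (f : ℕ → Bool), swapPair (l + 2 + k) f l = f l :=
      fun f => swapPair_of_ne (by omega) (by omega)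
    have e12 : ∀ (f : ℕ → Bool), swapPair (l + 2 + k) f (l + 1) = f (l + 1) :=
      fun f => swapPair_of_ne (by omega) (by omega)
    obtain _ | _ | s := a <;> obtain _ | _ | t := b <;>
      simp only [Coloured, Piece.dom, Piece.cod, add_zero, e1, e2, e3, e4, e5, e6, e7, e8, e9, e10,
        e11, e12, insertPair_insertPair, deletePair_insertPair_far, swapPair_insertPair_far,
        deletePair_insertPair_add, deletePair_deletePair, swapPair_deletePair_far,
        swapPair_insertPair_add, deletePair_swapPair_far, swapPair_swapPair_far]
    · constructor
      · rintro ⟨x, S', ⟨y, S'', ⟨rfl, rfl, rfl⟩, rfl⟩, rfl⟩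
        exact ⟨y, _, ⟨x, _, ⟨rfl, rfl, rfl⟩, rfl⟩, Set.insert_comm _ _ _⟩
      · rintro ⟨x, S', ⟨y, S'', ⟨rfl, rfl, rfl⟩, rfl⟩, rfl⟩
        exact ⟨y, _, ⟨x, _, ⟨rfl, rfl, rfl⟩, rfl⟩, Set.insert_comm _ _ _⟩
    · grind
    · grind
    · grind
    · grind
    · grind
    · grind
    · grind
    · grind
  | zigzag l r =>
    simp only [IsTangle, Slice.dom, Slice.cod, Piece.dom, Piece.cod] at hw
    -- The maximum that disappears lies on a strand coming from the top line. Its colour may leave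
    -- `S`, which is why sets of colours are compared only after adding those of the top line.
    have hm : f l ∈ f '' Set.Iio m := ⟨l, by simp only [Set.mem_Iio]; omega, rfl⟩
    have e1 : ∀ (x : Bool) (f : ℕ → Bool), insertPair l x f (l + 1) = x :=
      fun x f => insertPair_of_mem (by omega) (by omega)
    have e2 : ∀ (x : Bool) (f : ℕ → Bool), insertPair l x f (l + 1 + 1) = f l :=
      fun x f => insertPair_add (by omega)
    simp only [Coloured, e1, e2]
    constructor
    · rintro S ⟨x, S', ⟨rfl, rfl, rfl, rfl⟩, rfl⟩
      exact ⟨∅, ⟨by rw [deletePair_succ_insertPair l rfl], rfl, rfl⟩, by simp [hm]⟩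
    · rintro S ⟨rfl, rfl, rfl⟩
      exact ⟨_, ⟨g l, ∅, ⟨rfl, (deletePair_succ_insertPair l rfl).symm, rfl, rfl⟩, rfl⟩,
        by simp [hm]⟩
  | zagzig l r =>
    simp only [IsTangle, Slice.dom, Slice.cod, Piece.dom, Piece.cod] at hw
    have hm : f l ∈ f '' Set.Iio m := ⟨l, by simp only [Set.mem_Iio]; omega, rfl⟩
    have e1 : ∀ (x : Bool) (f : ℕ → Bool), insertPair (l + 1) x f (l + 1) = x :=
      fun x f => insertPair_of_mem (by omega) (by omega)
    have e2 : ∀ (x : Bool) (f : ℕ → Bool), insertPair (l + 1) x f l = f l :=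
      fun x f => insertPair_of_lt (by omega)
    simp only [Coloured, e1, e2]
    constructor
    · rintro S ⟨x, S', ⟨rfl, rfl, rfl, rfl⟩, rfl⟩
      exact ⟨∅, ⟨by rw [deletePair_insertPair_succ l rfl], rfl, rfl⟩, by simp [hm]⟩
    · rintro S ⟨rfl, rfl, rfl⟩
      exact ⟨_, ⟨g l, ∅, ⟨rfl, (deletePair_insertPair_succ l rfl).symm, rfl, rfl⟩, rfl⟩,
        by simp [hm]⟩
  | turnCap l r s =>
    apply key
    intro S
    have e1 : ∀ (x : Bool) (f : ℕ → Bool), insertPair l x f (l + 1) = x :=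
      fun x f => insertPair_of_mem (by omega) (by omega)
    have e2 : ∀ (x : Bool) (f : ℕ → Bool), insertPair l x f (l + 1 + 1) = f l :=
      fun x f => insertPair_add (by omega)
    have e3 : ∀ (x : Bool) (f : ℕ → Bool), insertPair (l + 1) x f (l + 1) = x :=
      fun x f => insertPair_of_mem (by omega) (by omega)
    have e4 : ∀ (x : Bool) (f : ℕ → Bool), insertPair (l + 1) x f l = f l :=
      fun x f => insertPair_of_lt (by omega)
    simp only [Coloured, e1, e2, e3, e4, swapPair_succ_insertPair, overWeight_opp]
  | turnCup l r s =>
    apply key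
    intro S
    have e1 : swapPair (l + 1) f l = f l := swapPair_of_ne (by omega) (by omega)
    have e2 : swapPair l f (l + 1 + 1) = f (l + 2) := swapPair_of_ne (by omega) (by omega)
    simp only [Coloured, e1, e2, swapPair_left, swapPair_right, overWeight_opp]
    constructor
    · rintro ⟨q, ⟨h, rfl, rfl, rfl⟩, rfl⟩
      exact ⟨_, ⟨h, deletePair_swapPair_succ l f, rfl, rfl⟩, by rw [h]⟩
    · rintro ⟨q, ⟨h, rfl, rfl, rfl⟩, rfl⟩
      exact ⟨_, ⟨h, (deletePair_swapPair_succ l f).symm, rfl, rfl⟩, by rw [h]⟩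
  | R1cap l r s =>
    apply key
    intro S
    have e : ∀ x, insertPair l x f l = insertPair l x f (l + 1) := fun x => by
      rw [insertPair_of_mem (by omega) (by omega), insertPair_of_mem (by omega) (by omega)]
    simp only [Coloured, swapPair_eq_self (e _), e, overWeight_self]
    simp
  | R1cup l r s =>
    apply key
    intro S
    simp only [Coloured, swapPair_left, swapPair_right]
    constructor
    · rintro ⟨q, ⟨h, rfl, rfl, rfl⟩, rfl⟩
      rw [swapPair_eq_self h.symm, h, overWeight_self]
      simp
    · rintro ⟨h, rfl, rfl, rfl⟩
      rw [swapPair_eq_self h, h, overWeight_self]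
      simp
  | R2 l r s =>
    apply key
    intro S
    -- The second crossing meets the colours in exchanged order and with the opposite slope, so both
    -- crossings have the same weight, and the two cancel modulo two.
    have e : ∀ q : ZMod 2, q + q = 0 := by decide
    simp only [Coloured, swapPair_left, swapPair_right, overWeight_opp, swapPair_swapPair]
    constructor
    · rintro ⟨q, ⟨q', ⟨rfl, rfl, rfl⟩, rfl⟩, rfl⟩
      exact ⟨rfl, by rw [add_zero, e], rfl⟩
    · rintro ⟨rfl, rfl, rfl⟩
      exact ⟨_, ⟨0, ⟨rfl, rfl, rfl⟩, rfl⟩, by rw [add_zero, e]⟩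
  | R3 l r s t u hs =>
    apply key
    intro S
    have e1 : ∀ f, swapPair (l + 1) f l = f l := fun f => swapPair_of_ne (by omega) (by omega)
    have e2 : ∀ f, swapPair l f (l + 1 + 1) = f (l + 1 + 1) :=
      fun f => swapPair_of_ne (by omega) (by omega)
    simp only [Coloured, swapPair_left, swapPair_right, swapPair_braid, e1, e2]
    -- Both sides of R3 cross the same three pairs of strands with the same slopes, only in reverse
    -- order.
    have e : ∀ x y z, overWeight s x y + overWeight t x z + overWeight u y z =
        overWeight u y z + overWeight t x z + overWeight s x y := fun x y z => by ring
    grind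

/-- In each colouring of `D` in which both colours occur, the number of crossings of `true` over
`false` is odd. -/
def LinkDiagram.OddlyLinked (D : LinkDiagram) : Prop :=
  ∀ (f g : ℕ → Bool) (p : ZMod 2) (S : Set Bool), Coloured f D.word g p S → true ∈ S →
    false ∈ S → p = 1

/-- The colours on the line just above the replaced piece already occur higher up, by
`Coloured.bottom_mem`, so the local discrepancy allowed by `LocalMove.coloured` is absorbed in the
whole diagram. -/
theorem union_image_congr {f h : ℕ → Bool} {S₁ S₂ S₂' S₃ : Set Bool} {m n : ℕ}
    (hh : ∀ i < m, h i ∈ S₁ ∪ f '' Set.Iio n)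
    (hS : S₂' ∪ h '' Set.Iio m = S₂ ∪ h '' Set.Iio m) :
    S₁ ∪ (S₂' ∪ S₃) ∪ f '' Set.Iio n = S₁ ∪ (S₂ ∪ S₃) ∪ f '' Set.Iio n := by
  have hsub : h '' Set.Iio m ⊆ S₁ ∪ f '' Set.Iio n := by
    rintro _ ⟨i, hi, rfl⟩
    exact hh i hi
  have e : ∀ A : Set Bool, S₁ ∪ (A ∪ S₃) ∪ f '' Set.Iio n =
      (S₁ ∪ f '' Set.Iio n) ∪ (A ∪ h '' Set.Iio m) ∪ S₃ := by
    intro A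
    rw [← Set.union_eq_self_of_subset_right hsub]
    ext x
    have hx := @hsub x
    simp only [Set.mem_union] at hx ⊢
    tauto
  rw [e, e, hS]

theorem LinkDiagram.Step.oddlyLinked_iff {D E : LinkDiagram} (h : D.Step E) :
    D.OddlyLinked ↔ E.OddlyLinked := by
  obtain ⟨u, v, w, w', hw, hD, hE⟩ := h
  have hc := D.closed
  rw [hD, List.append_assoc, isTangle_append] at hc
  obtain ⟨m, hu, hc⟩ := hc
  obtain ⟨n, hwt, hv⟩ := isTangle_append.1 hc
  constructor
  · intro hO f g p S h ht hf
    rw [hE, List.append_assoc, coloured_append] at h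
    obtain ⟨h₁, p₁, _, S₁, _, c₁, c, rfl, rfl⟩ := h
    obtain ⟨h₂, p₂, p₃, S₂, S₃, c₂, c₃, rfl, rfl⟩ := coloured_append.1 c
    obtain ⟨S₂', c₂', hS⟩ := (hw.coloured hwt).2 _ c₂
    have e := union_image_congr (S₃ := S₃) (fun i hi => c₁.bottom_mem hu hi) hS
    -- A closed diagram has no strand on its top line, so the correction terms vanish and the two
    -- sets of colours coincide.
    simp only [Set.image_empty, Set.union_empty, Set.Iio_bot, ← Nat.bot_eq_zero] at e
    refine hO f g _ _ ?_ (e.symm ▸ ht) (e.symm ▸ hf)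
    rw [hD, List.append_assoc]
    exact coloured_append.2 ⟨_, _, _, _, _, c₁,
      coloured_append.2 ⟨_, _, _, _, _, c₂', c₃, rfl, rfl⟩, rfl, rfl⟩
  · intro hO f g p S h ht hf
    rw [hD, List.append_assoc, coloured_append] at h
    obtain ⟨h₁, p₁, _, S₁, _, c₁, c, rfl, rfl⟩ := h
    obtain ⟨h₂, p₂, p₃, S₂, S₃, c₂, c₃, rfl, rfl⟩ := coloured_append.1 c
    obtain ⟨S₂', c₂', hS⟩ := (hw.coloured hwt).1 _ c₂
    have e := union_image_congr (S₃ := S₃) (fun i hi => c₁.bottom_mem hu hi) hS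
    simp only [Set.image_empty, Set.union_empty, Set.Iio_bot, ← Nat.bot_eq_zero] at e
    refine hO f g _ _ ?_ (e.symm ▸ ht) (e.symm ▸ hf)
    rw [hE, List.append_assoc]
    exact coloured_append.2 ⟨_, _, _, _, _, c₁,
      coloured_append.2 ⟨_, _, _, _, _, c₂', c₃, rfl, rfl⟩, rfl, rfl⟩

theorem LinkDiagram.Equivalent.oddlyLinked_iff {D E : LinkDiagram} (h : D.Equivalent E) :
    D.OddlyLinked ↔ E.OddlyLinked := by
  induction h with
  | rel _ _ h => exact h.oddlyLinked_iff
  | refl _ => rfl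
  | symm _ _ _ ih => exact ih.symm
  | trans _ _ _ _ _ ih₁ ih₂ => exact ih₁.trans ih₂

/-- A word has a colouring with the colour `false` only. -/
theorem exists_coloured_false (w : Word Slope) :
    ∃ S, Coloured (fun _ => false) w (fun _ => false) 0 S ∧
      ((∃ l r, ⟨l, .cap, r⟩ ∈ w) → false ∈ S) := by
  induction w with
  | nil => exact ⟨∅, ⟨rfl, rfl, rfl⟩, by simp⟩
  | cons s w ih =>
    obtain ⟨S, h, hS⟩ := ih
    obtain ⟨l, _ | _ | s, r⟩ := s
    · have e : insertPair l false (fun _ => false) = fun _ => false := by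
        funext i
        simp [insertPair]
      exact ⟨insert false S, ⟨false, S, by rw [e]; exact h, rfl⟩, fun _ => Or.inl rfl⟩
    · have e : deletePair l (fun _ => false) = fun _ => false := by
        funext i
        simp [deletePair]
      exact ⟨S, ⟨rfl, by rw [e]; exact h⟩, fun ⟨a, b, hab⟩ => hS ⟨a, b, by simpa using hab⟩⟩
    · refine ⟨S, ⟨0, by rw [swapPair_eq_self rfl]; exact h, by rw [overWeight_self]; rfl⟩,
        fun ⟨a, b, hab⟩ => hS ⟨a, b, by simpa using hab⟩⟩

/-- A word of width `m` to the right of `k` strands can be coloured with `true`, the strands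
outside with `false`. -/
theorem exists_coloured_whisker (k l : ℕ) {w : Word Slope} {m n : ℕ} (hw : IsTangle m w n) :
    ∃ S, Coloured (fun i => decide (k ≤ i ∧ i < k + m)) (whisker k l w)
        (fun i => decide (k ≤ i ∧ i < k + n)) 0 S ∧
      ((∃ l r, ⟨l, .cap, r⟩ ∈ w) → true ∈ S) := by
  induction w generalizing m with
  | nil =>
    cases hw
    exact ⟨∅, ⟨rfl, rfl, rfl⟩, by simp⟩
  | cons s w ih =>
    obtain ⟨hd, hw⟩ := hw
    obtain ⟨S, h, hS⟩ := ih hw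
    obtain ⟨a, _ | _ | s, b⟩ := s <;> simp only [Slice.dom, Slice.cod, Piece.dom, Piece.cod] at hd h
    · have e : insertPair (k + a) true (fun i => decide (k ≤ i ∧ i < k + m)) =
          fun i => decide (k ≤ i ∧ i < k + (a + 2 + b)) := by
        funext i
        simp only [insertPair]
        split_ifs
        · congr 1; apply propext; omega
        · symm; simp only [decide_eq_true_eq]; omega
        · congr 1; apply propext; omega
      exact ⟨insert true S, ⟨true, S, by rw [e]; exact h, rfl⟩, fun _ => Or.inl rfl⟩
    · have e : deletePair (k + a) (fun i => decide (k ≤ i ∧ i < k + m)) =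
          fun i => decide (k ≤ i ∧ i < k + (a + 0 + b)) := by
        funext i
        simp only [deletePair]
        split_ifs
        · congr 1; apply propext; omega
        · congr 1; apply propext; omega
      refine ⟨S, ⟨?_, by rw [e]; exact h⟩, fun ⟨a, b, hab⟩ => hS ⟨a, b, by simpa using hab⟩⟩
      simp only [decide_eq_decide]
      omega
    · have e : decide (k ≤ k + a ∧ k + a < k + m) = decide (k ≤ k + a + 1 ∧ k + a + 1 < k + m) := by
        congr 1; apply propext; omega
      refine ⟨S, ⟨0, ?_, ?_⟩, fun ⟨a, b, hab⟩ => hS ⟨a, b, by simpa using hab⟩⟩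
      · rw [swapPair_eq_self e, ← hd]; exact h
      · simp only [e, overWeight_self, add_zero]

/-- Only a maximum can follow a line without strands. This guarantees that a nonempty closed part
really shows its colour. -/
theorem exists_cap_mem {C : Type} {w : Word C} {n : ℕ} (hw : IsTangle 0 w n) (hne : w ≠ []) :
    ∃ l r, ⟨l, .cap, r⟩ ∈ w := by
  obtain _ | ⟨⟨l, _ | _ | c, r⟩, w⟩ := w
  · exact absurd rfl hne
  · exact ⟨l, r, by simp⟩
  · have := hw.1
    simp [Slice.dom, Piece.dom] at this
  · have := hw.1
    simp [Slice.dom, Piece.dom] at this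

theorem isTangle_unique {C : Type} {w : Word C} {m n n' : ℕ} (h : IsTangle m w n)
    (h' : IsTangle m w n') : n = n' := by
  induction w generalizing m with
  | nil => exact h.symm.trans h'
  | cons s w ih => exact ih h.2 h'.2

/-- Colour the part inside the rectangle `true` and everything else `false`: no crossing is mixed,
so the count is zero, although both colours occur. -/
theorem LinkDiagram.IsSplit.not_oddlyLinked {D : LinkDiagram} (h : D.IsSplit) :
    ¬ D.OddlyLinked := by
  obtain ⟨u, v, T, k, l, hT, hne, huv, hD⟩ := h
  have hc := D.closed
  rw [hD, List.append_assoc, isTangle_append] at hc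
  obtain ⟨m, hu, hc⟩ := hc
  obtain ⟨n, hTt, hv⟩ := isTangle_append.1 hc
  have hcap : ∃ l r, ⟨l, .cap, r⟩ ∈ u ++ v := by
    -- If nothing lies above the rectangle, no strand passes beside it, so `v` again starts from an
    -- empty line and opens with a maximum.
    by_cases h0 : u = []
    · subst h0
      cases hu
      obtain _ | ⟨s, T⟩ := T
      · exact absurd rfl hne
      · have h1 := hT.1
        have h2 := hTt.1
        simp only [Slice.dom] at h1 h2
        obtain rfl : k = 0 := by omega
        obtain rfl : l = 0 := by omega
        obtain rfl := isTangle_unique hTt (hT.whisker 0 0)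
        exact exists_cap_mem hv huv
    · obtain ⟨a, b, h⟩ := exists_cap_mem hu h0
      exact ⟨a, b, by simp [h]⟩
  obtain ⟨S₁, h₁, hS₁⟩ := exists_coloured_false u
  obtain ⟨S₂, h₂, hS₂⟩ := exists_coloured_whisker k l hT
  obtain ⟨S₃, h₃, hS₃⟩ := exists_coloured_false v
  have e : (fun i => decide (k ≤ i ∧ i < k + 0)) = fun _ => false := by
    funext i
    simp
  rw [e] at h₂
  intro hO
  have := hO _ _ (0 + (0 + 0)) (S₁ ∪ (S₂ ∪ S₃)) (by
    rw [hD, List.append_assoc]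
    exact coloured_append.2 ⟨_, _, _, _, _, h₁,
      coloured_append.2 ⟨_, _, _, _, _, h₂, h₃, rfl, rfl⟩, rfl, rfl⟩)
    (Or.inr (Or.inl (hS₂ (exists_cap_mem hT hne))))
    (by
      obtain ⟨a, b, h⟩ := hcap
      rcases List.mem_append.1 h with h | h
      · exact Or.inl (hS₁ ⟨a, b, h⟩)
      · exact Or.inr (Or.inr (hS₃ ⟨a, b, h⟩)))
  exact absurd this (by decide)

theorem LinkDiagram.OddlyLinked.not_splittable {D : LinkDiagram} (h : D.OddlyLinked) :
    ¬ D.Splittable := fun ⟨_, hDE, hE⟩ => hE.not_oddlyLinked (hDE.oddlyLinked_iff.1 h)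

/-! ## Colourings of the components -/

theorem getElem?_word_map {C C' : Type} (φ : C → C') (D : Diagram C) (j : ℕ) :
    (D.map φ).word[j]? = D.word[j]?.map (Slice.map φ) := by
  simp [Diagram.map]

theorem Diagram.Joined.map {C C' : Type} (φ : C → C') {D : Diagram C} {x y : ℕ × ℕ}
    (h : D.Joined x y) : (D.map φ).Joined x y := by
  cases h with
  | left h hp => exact .left (s := Slice.map φ _) (by rw [getElem?_word_map, h]; rfl) hp
  | @right j p s h hp =>
    have := Joined.right (D := D.map φ) (j := j) (p := p) (s := Slice.map φ s)
      (by rw [getElem?_word_map, h]; rfl) hp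
    obtain ⟨l, _ | _ | c, r⟩ := s <;> exact this
  | cap h => exact .cap (by rw [getElem?_word_map, h]; rfl)
  | cup h => exact .cup (by rw [getElem?_word_map, h]; rfl)
  | crossDown h => exact .crossDown (by rw [getElem?_word_map, h]; rfl)
  | crossUp h => exact .crossUp (by rw [getElem?_word_map, h]; rfl)

theorem Diagram.isPoint_map {C C' : Type} (φ : C → C') {D : Diagram C} {x : ℕ × ℕ} :
    (D.map φ).IsPoint x ↔ D.IsPoint x := by
  simp only [Diagram.IsPoint, getElem?_word_map, Option.map_eq_some_iff]
  constructor
  · rintro ⟨_, ⟨s, h, rfl⟩, hx⟩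
    exact ⟨s, h, s.dom_map φ ▸ hx⟩
  · rintro ⟨s, h, hx⟩
    exact ⟨_, ⟨s, h, rfl⟩, (s.dom_map φ).symm ▸ hx⟩

/-- The points of a diagram with two components have a colouring with two colours. -/
theorem Diagram.exists_colouring {C : Type} {D : Diagram C} (h : D.numComponents = 2) :
    ∃ col : ℕ × ℕ → Bool,
      (∀ x y, D.IsPoint x → D.IsPoint y → D.Joined x y → col x = col y) ∧
      (∀ x, ¬ D.IsPoint x → col x = false) ∧
      ∀ b, ∃ x, D.IsPoint x ∧ col x = b := by
  classical
  obtain ⟨a, b, hab, -⟩ := Nat.card_eq_two_iff.1 h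
  refine ⟨fun x => if hx : D.IsPoint x then decide ((Quot.mk _ ⟨x, hx⟩ : D.Component) = a)
    else false, ?_, ?_, ?_⟩
  · intro x y hx hy hxy
    simp only [hx, hy, dif_pos]
    rw [show (Quot.mk _ ⟨x, hx⟩ : D.Component) = Quot.mk _ ⟨y, hy⟩ from Quot.sound hxy]
  · intro x hx
    simp [hx]
  · intro t
    cases t
    · obtain ⟨⟨x, hx⟩, rfl⟩ := Quot.exists_rep b
      exact ⟨x, hx, by simpa [hx] using fun h => hab h.symm⟩
    · obtain ⟨⟨x, hx⟩, rfl⟩ := Quot.exists_rep a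
      exact ⟨x, hx, by simp [hx]⟩

theorem Diagram.isPoint_iff_of_append {C : Type} {D : Diagram C} {u w : Word C} {m p : ℕ}
    (hD : D.word = u ++ w) (hu : IsTangle 0 u m) : D.IsPoint (u.length, p) ↔ p < m := by
  have hc := D.closed
  rw [hD] at hc
  obtain ⟨k, hu', hw⟩ := isTangle_append.1 hc
  obtain rfl := isTangle_unique hu hu'
  simp only [Diagram.IsPoint, hD, List.getElem?_append_right le_rfl, Nat.sub_self]
  obtain _ | ⟨s, w⟩ := w
  · cases hw
    simp
  · simp [hw.1]

/-- Constancy along joined points is exactly the local rule that `Coloured` imposes at each kind of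
piece. The value `false` off the diagram makes the rule hold also for the irrelevant positions
beyond the last strand. -/
theorem Diagram.coloured_slice {D : LinkDiagram} {col : ℕ × ℕ → Bool}
    (hJ : ∀ x y, D.IsPoint x → D.IsPoint y → D.Joined x y → col x = col y)
    (hP : ∀ x, ¬ D.IsPoint x → col x = false) {u w : Word Slope} {s : Slice Slope}
    (hD : D.word = u ++ s :: w) (hu : IsTangle 0 u s.dom) :
    ∃ p S, Coloured (fun i => col (u.length, i)) [s] (fun i => col (u.length + 1, i)) p S := by
  have hs : D.word[u.length]? = some s := by simp [hD]
  have h₁ : ∀ p, D.IsPoint (u.length, p) ↔ p < s.dom := fun p =>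
    Diagram.isPoint_iff_of_append hD hu
  have h₂ : ∀ p, D.IsPoint (u.length + 1, p) ↔ p < s.cod := fun p => by
    have := Diagram.isPoint_iff_of_append (D := D) (u := u ++ [s]) (w := w) (m := s.cod) (p := p)
      (by simp [hD]) (hu.append ⟨rfl, rfl⟩)
    simpa using this
  have hL : ∀ p < s.left, col (u.length, p) = col (u.length + 1, p) := fun p hp =>
    hJ _ _ ((h₁ _).2 (by simp only [Slice.dom]; omega)) ((h₂ _).2 (by simp only [Slice.cod]; omega))
      (.left hs hp)
  have hR : ∀ p, col (u.length, s.left + s.piece.dom + p) =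
      col (u.length + 1, s.left + s.piece.cod + p) := fun p => by
    by_cases hp : p < s.right
    · exact hJ _ _ ((h₁ _).2 (by simp only [Slice.dom]; omega))
        ((h₂ _).2 (by simp only [Slice.cod]; omega)) (.right hs hp)
    · rw [hP _ fun h => hp (by have := (h₁ _).1 h; simp only [Slice.dom] at this; omega),
        hP _ fun h => hp (by have := (h₂ _).1 h; simp only [Slice.cod] at this; omega)]
  obtain ⟨l, _ | _ | c, r⟩ := s <;>
    simp only [Slice.dom, Slice.cod, Piece.dom, Piece.cod] at h₁ h₂ hL hR
  · have hx := hJ _ _ ((h₂ _).2 (by omega)) ((h₂ _).2 (by omega)) (.cap hs)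
    refine ⟨0, _, col (u.length + 1, l), ∅, ⟨?_, rfl, rfl⟩, rfl⟩
    funext i
    simp only [insertPair]
    split_ifs with ha hb
    · exact (hL i ha).symm
    · obtain rfl | rfl : i = l ∨ i = l + 1 := by omega
      · rfl
      · exact hx.symm
    · have := hR (i - 2 - l)
      rw [show l + 0 + (i - 2 - l) = i - 2 by omega, show l + 2 + (i - 2 - l) = i by omega] at this
      exact this.symm
  · have hx := hJ _ _ ((h₁ _).2 (by omega)) ((h₁ _).2 (by omega)) (.cup hs)
    refine ⟨0, ∅, hx, ?_, rfl, rfl⟩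
    funext i
    simp only [deletePair]
    split_ifs with ha
    · exact (hL i ha).symm
    · have := hR (i - l)
      rw [show l + 0 + (i - l) = i by omega, show l + 2 + (i - l) = i + 2 by omega] at this
      exact this.symm
  · have hx := hJ _ _ ((h₁ _).2 (by omega)) ((h₂ _).2 (by omega)) (.crossDown hs)
    have hy := hJ _ _ ((h₁ _).2 (by omega)) ((h₂ _).2 (by omega)) (.crossUp hs)
    refine ⟨_, ∅, 0, ⟨?_, rfl, rfl⟩, rfl⟩
    funext i
    simp only [swapPair]
    split_ifs with ha hb
    · rw [ha, hy]
    · rw [hb, hx]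
    · by_cases hi : i < l
      · exact (hL i hi).symm
      · have := hR (i - l - 2)
        rw [show l + 2 + (i - l - 2) = i by omega] at this
        exact this.symm

/-- The slices are glued from bottom to top. The second conclusion says that no colour gets lost: it
is passed up from line to line until it is found at a maximum or on the first line considered, which
is empty when `u` is. -/
theorem Diagram.exists_coloured {D : LinkDiagram} {col : ℕ × ℕ → Bool}
    (hJ : ∀ x y, D.IsPoint x → D.IsPoint y → D.Joined x y → col x = col y)
    (hP : ∀ x, ¬ D.IsPoint x → col x = false) {u w : Word Slope} {m : ℕ}
    (hD : D.word = u ++ w) (hu : IsTangle 0 u m) (hw : IsTangle m w 0) :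
    ∃ g p S, Coloured (fun i => col (u.length, i)) w g p S ∧
      ∀ j i, u.length ≤ j → D.IsPoint (j, i) →
        col (j, i) ∈ S ∪ (fun i => col (u.length, i)) '' Set.Iio m := by
  induction w generalizing u m with
  | nil =>
    refine ⟨_, 0, ∅, ⟨rfl, rfl, rfl⟩, fun j i hj hi => ?_⟩
    obtain ⟨s, hs, -⟩ := hi
    rw [hD, List.append_nil] at hs
    have := (List.getElem?_eq_some_iff.1 hs).1
    simp only at this
    omega
  | cons s w ih =>
    obtain ⟨rfl, hw⟩ := hw
    obtain ⟨p₁, S₁, h₁⟩ := Diagram.coloured_slice hJ hP hD hu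
    obtain ⟨g, p₂, S₂, h₂, hS⟩ := ih (u := u ++ [s]) (by simp [hD]) (hu.append ⟨rfl, rfl⟩) hw
    simp only [List.length_append, List.length_singleton] at h₂ hS
    refine ⟨g, _, _, coloured_append (u := [s]).2 ⟨_, _, _, _, _, h₁, h₂, rfl, rfl⟩,
      fun j i hj hi => ?_⟩
    obtain rfl | hj := hj.eq_or_lt
    · exact Or.inr ⟨i, (Diagram.isPoint_iff_of_append hD hu).1 hi, rfl⟩
    · rcases hS j i hj hi with h | ⟨k, hk, h⟩
      · exact Or.inl (Or.inr h)
      · rcases h₁.bottom_mem (show IsTangle s.dom [s] s.cod from ⟨rfl, rfl⟩) hk with h' | h'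
        · exact Or.inl (Or.inl (h ▸ h'))
        · exact Or.inr (h ▸ h')

/-- A link diagram with two components has a colouring in which both colours occur. -/
theorem LinkDiagram.exists_coloured_of_numComponents {D : LinkDiagram}
    (h : D.shadow.numComponents = 2) :
    ∃ f g p S, Coloured f D.word g p S ∧ ∀ b, b ∈ S := by
  obtain ⟨col, hJ, hP, hb⟩ := Diagram.exists_colouring h
  simp only [LinkDiagram.shadow, Diagram.isPoint_map] at hJ hP hb
  obtain ⟨g, p, S, hc, hS⟩ := Diagram.exists_coloured (D := D) (col := col) (u := []) (w := D.word)
    (fun x y hx hy hxy => hJ x y hx hy (hxy.map _)) hP rfl rfl D.closed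
  refine ⟨_, g, p, S, hc, fun b => ?_⟩
  obtain ⟨x, hx, rfl⟩ := hb b
  rcases hS x.1 x.2 (Nat.zero_le _) hx with h | ⟨i, hi, -⟩
  · exact h
  · exact absurd hi (Nat.not_lt_zero _)

/-! ## Tangles with two vertical strands -/

/-- The contribution of a bottom twist to the linking number modulo two. -/
def Slope.weight : Slope → ZMod 2
  | .pos => 0
  | .neg => 1

/-- Tangles built by right twists and by pairs of bottom twists. The strands of such a tangle go
from the top left to the bottom left and from the top right to the bottom right; the index is the
number of crossings modulo two at which the one lies over the other. -/
inductive IsVertical : Word Slope → ZMod 2 → Prop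
  | nil : IsVertical [] 0
  | right {T : Word Slope} {e : ZMod 2} (s : Slope) (h : IsVertical T e) :
      IsVertical (twistRight s T) e
  | bottom {T : Word Slope} {e : ZMod 2} (s t : Slope) (h : IsVertical T e) :
      IsVertical (twistBottom t (twistBottom s T)) (e + (1 + s.weight + t.weight))

theorem whisker_append {C : Type} (k l : ℕ) (v w : Word C) :
    whisker k l (v ++ w) = whisker k l v ++ whisker k l w := by simp [whisker]

theorem whisker_whisker {C : Type} (k l k' l' : ℕ) (w : Word C) :
    whisker k l (whisker k' l' w) = whisker (k + k') (l' + l) w := by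
  simp [whisker, Function.comp_def, Nat.add_assoc]

/-- Two consecutive bottom twists cross the same two strands in exchanged order. With equal slopes
each strand is over once; with opposite slopes one strand is over both times or never. -/
theorem overWeight_pair {s t : Slope} {x y : Bool} :
    overWeight s x y + overWeight t y x = if x = y then 0 else 1 + s.weight + t.weight := by
  revert s t x y
  rintro (_ | _) (_ | _) (_ | _) (_ | _) <;> decide

/-- A vertical tangle is colour-wise like two parallel strands: the maxima inside bring no new
colour, and only bottom twists can be mixed crossings. The offset `k` lets the induction pass
through the whiskering in `twistRight`. -/
theorem IsVertical.coloured {T : Word Slope} {e : ZMod 2} (hT : IsVertical T e) {k l : ℕ}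
    {f g : ℕ → Bool} {p : ZMod 2} {S : Set Bool} (h : Coloured f (whisker k l T) g p S) :
    g = f ∧ (∀ x ∈ S, x = f k ∨ x = f (k + 1)) ∧ p = if f k = f (k + 1) then 0 else e := by
  induction hT generalizing k l f g p S with
  | nil =>
    obtain ⟨rfl, rfl, rfl⟩ := h
    simp
  | @right T e s _ ih =>
    simp only [twistRight, whisker_append, whisker_whisker, List.append_assoc] at h
    obtain ⟨x, S', h, rfl⟩ := h
    obtain ⟨f₁, p₁, p₂, S₁, S₂, h₁, h₂, rfl, rfl⟩ :=
      (coloured_append (u := whisker (k + 0) (2 + l) T)).1 h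
    obtain ⟨rfl, hS, rfl⟩ := ih h₁
    obtain ⟨q, ⟨h₂, rfl, rfl, rfl⟩, rfl⟩ := h₂
    simp only [Nat.add_zero] at hS h₂ ⊢
    have e0 : insertPair (k + 1) x f k = f k := insertPair_of_lt (by omega)
    have e1 : insertPair (k + 1) x f (k + 1) = x := insertPair_of_mem (by omega) (by omega)
    have e2 : insertPair (k + 1) x f (k + 2) = x := insertPair_of_mem (by omega) (by omega)
    have e3 : insertPair (k + 1) x f (k + 2 + 1) = f (k + 1) := insertPair_add (i := k + 1) le_rfl
    -- The final minimum meets the colours `x` and `f (k + 1)`. Hence the new maximum belongs to the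
    -- right strand, and the added crossing is a self-crossing of weight zero.
    rw [swapPair_of_ne (by omega) (by omega), e1, show k + 1 + 1 = k + 2 by ring, swapPair_left,
      e3] at h₂
    subst h₂
    rw [e0, e1] at hS
    simp only [e0, e1, e2, e3, overWeight_self, add_zero, and_true]
    refine ⟨?_, ?_⟩
    · rw [swapPair_eq_self (by rw [e2, e3]), deletePair_insertPair]
    · rintro x (rfl | hx)
      · exact Or.inr rfl
      · exact hS x (by simpa using hx)
  | @bottom T e s t _ ih =>
    simp only [twistBottom, whisker_append, List.append_assoc] at h
    obtain ⟨f₁, p₁, p₂, S₁, S₂, h₁, h₂, rfl, rfl⟩ := coloured_append.1 h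
    obtain ⟨rfl, hS, rfl⟩ := ih h₁
    obtain ⟨q, ⟨q, ⟨rfl, rfl, rfl⟩, rfl⟩, rfl⟩ := h₂
    simp only [swapPair_left, swapPair_right, add_zero, overWeight_pair]
    refine ⟨swapPair_swapPair _ _, by simpa using hS, ?_⟩
    split_ifs <;> simp

theorem IsVertical.iterate_right {T : Word Slope} {e : ZMod 2} (hT : IsVertical T e) (s : Slope)
    (n : ℕ) : IsVertical ((twistRight s)^[n] T) e := by
  induction n with
  | zero => exact hT
  | succ n ih => rw [Function.iterate_succ_apply']; exact ih.right s

theorem IsVertical.iterate_bottom {T : Word Slope} {e : ZMod 2} (hT : IsVertical T e) (s : Slope)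
    (n : ℕ) : ∃ e', IsVertical ((twistBottom s)^[n + n] T) e' := by
  induction n with
  | zero => exact ⟨e, hT⟩
  | succ n ih =>
    obtain ⟨e', h⟩ := ih
    rw [show n + 1 + (n + 1) = (n + n + 1) + 1 by ring, Function.iterate_succ_apply',
      Function.iterate_succ_apply']
    exact ⟨_, h.bottom s s⟩

/-- The syllables at the positions of the bottom twists are even. -/
def BottomEven : Bool → List ℤ → Prop
  | _, [] => True
  | true, a :: as => Even a ∧ BottomEven false as
  | false, _ :: as => BottomEven true as

/-- Right syllables may have any parity. The value of the index does not matter here: verticality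
alone rules out the numerator closure. -/
theorem IsVertical.addSyllables {T : Word Slope} {e : ZMod 2} (hT : IsVertical T e) {b : Bool}
    {a : List ℤ} (ha : BottomEven b a) : ∃ e', IsVertical (addSyllables b T a) e' := by
  induction a generalizing b T e with
  | nil => cases b <;> exact ⟨e, hT⟩
  | cons x a ih =>
    cases b
    · exact ih (hT.iterate_right _ _) ha
    · obtain ⟨n, hn⟩ := Int.natAbs_even.2 ha.1
      obtain ⟨e', h⟩ := hT.iterate_bottom (syllableSlope x) n
      have := ih h ha.2
      rw [← hn] at this
      exact this

theorem BottomEven.of_forall_even {b : Bool} {a : List ℤ} (h : ∀ x ∈ a, Even x) :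
    BottomEven b a := by
  induction a generalizing b with
  | nil => cases b <;> trivial
  | cons x a ih =>
    simp only [List.mem_cons, forall_eq_or_imp] at h
    cases b
    · exact ih h.2
    · exact ⟨h.1, ih h.2⟩

/-- The numerator closure of a vertical tangle has one colour only. -/
theorem IsVertical.not_coloured_numerator {T : Word Slope} {e : ZMod 2} (hT : IsVertical T e)
    {f g : ℕ → Bool} {p : ZMod 2} {S : Set Bool}
    (h : Coloured f (closeWord .numerator T) g p S) (hS : ∀ b, b ∈ S) : False := by
  obtain ⟨x, S', h, rfl⟩ := h
  obtain ⟨f₁, p₁, p₂, S₁, S₂, h₁, h₂, rfl, rfl⟩ := (coloured_append (u := T)).1 h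
  obtain ⟨-, -, rfl, rfl⟩ := h₂
  have e : whisker 0 0 T = T := by simp [whisker]
  obtain ⟨-, hS₁, -⟩ := hT.coloured (k := 0) (l := 0) (e.symm ▸ h₁)
  have := hS (!x)
  simp only [Set.union_empty, Set.mem_insert_iff] at this
  rcases this with h | h
  · simp at h
  · rcases hS₁ _ h with h | h <;>
      rw [insertPair_of_mem (by omega) (by omega)] at h <;> simp at h

/-- The denominator closure of a vertical tangle of odd index is not splittable. -/
theorem IsVertical.oddlyLinked {T : Word Slope} (hT : IsVertical T 1) {D : LinkDiagram}
    (hD : D.word = closeWord .denominator T) : D.OddlyLinked := by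
  intro f g p S h ht hf
  rw [hD] at h
  obtain ⟨x, S', ⟨y, S', h, rfl⟩, rfl⟩ := h
  obtain ⟨f₁, p₁, p₂, S₁, S₂, h₁, h₂, rfl, rfl⟩ :=
    (coloured_append (u := whisker 1 1 T)).1 h
  obtain ⟨-, hS, rfl⟩ := hT.coloured h₁
  obtain ⟨-, -, -, rfl, rfl⟩ := h₂
  have e1 : insertPair 2 y (insertPair 0 x f) 1 = x := by
    rw [insertPair_of_lt (by omega), insertPair_of_mem (by omega) (by omega)]
  have e2 : insertPair 2 y (insertPair 0 x f) (1 + 1) = y :=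
    insertPair_of_mem (by omega) (by omega)
  rw [e1, e2] at hS ⊢
  simp only [Set.union_empty, Set.mem_insert_iff] at ht hf
  rw [if_neg, add_zero]
  rintro rfl
  have h1 : true = x := by
    rcases ht with h | h | h
    · exact h
    · exact h
    · exact (hS _ h).elim id id
  have h2 : false = x := by
    rcases hf with h | h | h
    · exact h
    · exact h
    · exact (hS _ h).elim id id
  exact absurd (h1.trans h2.symm) (by decide)

/-! ## Simplifying tangles -/

/-- A sequence of local moves, applied in the forward direction inside a word. -/
def Reduces : Word Slope → Word Slope → Prop :=
  Relation.ReflTransGen fun w w' => ∃ u v a b, LocalMove a b ∧ w = u ++ a ++ v ∧ w' = u ++ b ++ v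

theorem LocalMove.reduces {a b : Word Slope} (h : LocalMove a b) (u v : Word Slope) :
    Reduces (u ++ a ++ v) (u ++ b ++ v) :=
  Relation.ReflTransGen.single ⟨u, v, a, b, h, rfl, rfl⟩

theorem Reduces.context {w w' : Word Slope} (h : Reduces w w') (u v : Word Slope) :
    Reduces (u ++ w ++ v) (u ++ w' ++ v) := by
  induction h with
  | refl => exact Relation.ReflTransGen.refl
  | tail _ h ih =>
    obtain ⟨u', v', a, b, hab, rfl, rfl⟩ := h
    exact ih.tail ⟨u ++ u', v' ++ v, a, b, hab, by simp, by simp⟩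

theorem LocalMove.whisker {a b : Word Slope} (h : LocalMove a b) (k l : ℕ) :
    LocalMove (whisker k l a) (whisker k l b) := by
  cases h with
  | interchange l' m r g h =>
    have := LocalMove.interchange (k + l') m (r + l) g h
    simpa only [LinkGame.whisker, List.map_cons, List.map_nil, Nat.add_assoc] using this
  | zigzag l' r =>
    have := LocalMove.zigzag (k + l') (r + l)
    simpa only [LinkGame.whisker, List.map_cons, List.map_nil, Nat.add_assoc, Nat.add_comm l 1]
      using this
  | zagzig l' r =>
    have := LocalMove.zagzig (k + l') (r + l)
    simpa only [LinkGame.whisker, List.map_cons, List.map_nil, Nat.add_assoc, Nat.add_comm l 1]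
      using this
  | turnCap l' r s =>
    have := LocalMove.turnCap (k + l') (r + l) s
    simpa only [LinkGame.whisker, List.map_cons, List.map_nil, Nat.add_assoc, Nat.add_comm l 1]
      using this
  | turnCup l' r s =>
    have := LocalMove.turnCup (k + l') (r + l) s
    simpa only [LinkGame.whisker, List.map_cons, List.map_nil, Nat.add_assoc, Nat.add_comm l 1]
      using this
  | R1cap l' r s => exact .R1cap (k + l') (r + l) s
  | R1cup l' r s => exact .R1cup (k + l') (r + l) s
  | R2 l' r s => exact .R2 (k + l') (r + l) s
  | R3 l' r s t u h =>
    have := LocalMove.R3 (k + l') (r + l) s t u h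
    simpa only [LinkGame.whisker, List.map_cons, List.map_nil, Nat.add_assoc, Nat.add_comm l 1]
      using this

theorem Reduces.whisker {w w' : Word Slope} (h : Reduces w w') (k l : ℕ) :
    Reduces (whisker k l w) (whisker k l w') := by
  induction h with
  | refl => exact Relation.ReflTransGen.refl
  | tail _ h ih =>
    obtain ⟨u', v', a, b, hab, rfl, rfl⟩ := h
    exact ih.tail ⟨LinkGame.whisker k l u', LinkGame.whisker k l v', _, _, hab.whisker k l, by simp only [whisker_append],
      by simp only [whisker_append]⟩

theorem Reduces.exists_equivalent {D : LinkDiagram} {w : Word Slope} (h : Reduces D.word w) :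
    ∃ E : LinkDiagram, E.word = w ∧ D.Equivalent E := by
  induction h with
  | refl => exact ⟨D, rfl, .refl _⟩
  | tail _ h ih =>
    obtain ⟨E, rfl, hE⟩ := ih
    obtain ⟨u, v, a, b, hab, h1, rfl⟩ := h
    have hc := E.closed
    rw [h1, List.append_assoc, isTangle_append] at hc
    obtain ⟨m, hu, hc⟩ := hc
    obtain ⟨n, ha, hv⟩ := isTangle_append.1 hc
    exact ⟨⟨u ++ b ++ v, (hu.append (hab.isTangle ha)).append hv⟩, rfl,
      hE.trans _ _ _ (.rel _ _ ⟨u, v, a, b, hab, h1, rfl⟩)⟩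

/-- Once the inner tangle is trivial, the crossing turns past the minimum and becomes a kink at the
maximum; R1 removes it and the remaining zigzag is straightened. The slope plays no role. -/
theorem Reduces.twistRight_nil {T : Word Slope} (hT : Reduces T []) (s : Slope) :
    Reduces (twistRight s T) [] :=
  ((hT.whisker 0 2).context _ _).trans <|
    ((LocalMove.turnCup 1 0 s).reduces [⟨1, .cap, 1⟩] []).trans <|
      ((LocalMove.R1cap 1 1 s.opp).reduces [] [⟨2, .cup, 0⟩]).trans <|
        (LocalMove.zigzag 1 0).reduces [] []

theorem Reduces.twistBottom_twistBottom_nil {T : Word Slope} (hT : Reduces T []) (s : Slope) :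
    Reduces (twistBottom s.opp (twistBottom s T)) [] := by
  have h := hT.context [] [⟨0, .cross s, 0⟩, ⟨0, .cross s.opp, 0⟩]
  rw [List.nil_append] at h
  simp only [twistBottom, List.append_assoc]
  exact h.trans ((LocalMove.R2 0 0 s).reduces [] [])

/-- After the reduction two circles lie side by side. -/
theorem Reduces.splittable {T : Word Slope} (hT : Reduces T []) {D : LinkDiagram}
    (hD : D.word = closeWord .denominator T) : D.Splittable := by
  have h := (hT.whisker 1 1).context [⟨0, .cap, 0⟩, ⟨2, .cap, 0⟩] [⟨0, .cup, 2⟩, ⟨0, .cup, 0⟩]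
  obtain ⟨E, hE, hDE⟩ := Reduces.exists_equivalent (D := D)
    (show Reduces D.word _ by rw [hD]; exact h)
  -- `IsSplit` asks for a contiguous block of slices. The interchange, used backwards, closes the
  -- first circle before the second one opens.
  refine ⟨⟨[⟨0, .cap, 0⟩, ⟨0, .cup, 0⟩, ⟨0, .cap, 0⟩, ⟨0, .cup, 0⟩], ⟨rfl, rfl, rfl, rfl, rfl⟩⟩,
    hDE.trans _ _ _ (.symm _ _ (.rel _ _ ⟨[⟨0, .cap, 0⟩], [⟨0, .cup, 0⟩], _, _,
      .interchange 0 0 0 .cup .cap, rfl, hE⟩)), ?_⟩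
  exact ⟨[], [⟨0, .cap, 0⟩, ⟨0, .cup, 0⟩], [⟨0, .cap, 0⟩, ⟨0, .cup, 0⟩], 0, 0, ⟨rfl, rfl, rfl⟩,
    by simp, by simp, rfl⟩

/-! ## Shapes and lists of crossings -/

/-- The shape of a word forgets the information at the crossings. -/
def shape {C : Type} (w : Word C) : Word Unit := w.map (Slice.map fun _ => ())

/-- The information at the crossings of a slice. -/
def Slice.crossings {C : Type} (s : Slice C) : List C :=
  match s.piece with
  | .cross c => [c]
  | _ => []

/-- The information at the crossings of a word, from top to bottom. -/
def crossings {C : Type} (w : Word C) : List C := w.flatMap Slice.crossings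

theorem shape_append {C : Type} (v w : Word C) : shape (v ++ w) = shape v ++ shape w := by
  simp [shape]

theorem crossings_append {C : Type} (v w : Word C) :
    crossings (v ++ w) = crossings v ++ crossings w := by simp [crossings]

theorem crossings_whisker {C : Type} (k l : ℕ) (w : Word C) :
    crossings (whisker k l w) = crossings w := by
  simp only [crossings, whisker, List.flatMap_map]
  rfl

theorem shape_whisker {C : Type} (k l : ℕ) (w : Word C) :
    shape (whisker k l w) = whisker k l (shape w) := by
  simp [shape, whisker, Slice.map]

theorem shape_map {C C' : Type} (φ : C → C') (w : Word C) :
    shape (w.map (Slice.map φ)) = shape w := by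
  simp only [shape, List.map_map]
  congr 1
  funext ⟨l, p, r⟩
  cases p <;> rfl

theorem crossings_map {C C' : Type} (φ : C → C') (w : Word C) :
    crossings (w.map (Slice.map φ)) = (crossings w).map φ := by
  simp only [crossings, List.flatMap_map, List.map_flatMap]
  congr 1
  funext ⟨l, p, r⟩
  cases p <;> rfl

/-- Moves preserve the shape, so a position of the game is determined by its list of crossings; the
strategies are therefore analysed on lists. -/
theorem word_ext {C : Type} {v w : Word C} (hs : shape v = shape w)
    (hc : crossings v = crossings w) : v = w := by
  induction v generalizing w with
  | nil =>
    cases w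
    · rfl
    · simp [shape] at hs
  | cons s v ih =>
    obtain _ | ⟨t, w⟩ := w
    · simp [shape] at hs
    · simp only [shape, List.map_cons, List.cons.injEq] at hs
      obtain ⟨l, p, r⟩ := s
      obtain ⟨l', p', r'⟩ := t
      have hv : v = w := ih hs.2 <| by
        cases p <;> cases p' <;> simp_all [Slice.map, Piece.map, crossings, Slice.crossings]
      cases p <;> cases p' <;> simp_all [Slice.map, Piece.map, crossings, Slice.crossings]

theorem length_crossings {C C' : Type} {v : Word C} {w : Word C'} (h : shape v = shape w) :
    (crossings v).length = (crossings w).length := by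
  have : ∀ {C : Type} (v : Word C), (crossings v).length = (crossings (shape v)).length :=
    fun v => by rw [shape, crossings_map, List.length_map]
  rw [this v, this w, h]

theorem isTangle_shape {C : Type} {w : Word C} {m n : ℕ} :
    IsTangle m (shape w) n ↔ IsTangle m w n := by
  refine ⟨fun h => ?_, fun h => h.map _⟩
  induction w generalizing m with
  | nil => exact h
  | cons s w ih =>
    refine ⟨(s.dom_map _).symm.trans h.1, ih ?_⟩
    have := h.2
    rwa [Slice.cod_map] at this

theorem exists_of_crossings_eq {C : Type} {w : Word C} {u v : List C} {c : C}
    (h : crossings w = u ++ c :: v) :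
    ∃ w₁ w₂ l r, w = w₁ ++ [⟨l, .cross c, r⟩] ++ w₂ ∧ crossings w₁ = u ∧ crossings w₂ = v := by
  induction w generalizing u with
  | nil => simp [crossings] at h
  | cons s w ih =>
    have e : crossings (s :: w) = s.crossings ++ crossings w := by simp [crossings]
    rw [e] at h
    by_cases hs : s.crossings = []
    · rw [hs, List.nil_append] at h
      obtain ⟨w₁, w₂, l, r, rfl, rfl, rfl⟩ := ih h
      exact ⟨s :: w₁, w₂, l, r, by simp, by simp [crossings, hs], rfl⟩
    · obtain ⟨l, _ | _ | d, r⟩ := s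
      · exact absurd rfl hs
      · exact absurd rfl hs
      · obtain _ | ⟨d', u⟩ := u
        · simp only [Slice.crossings, List.cons_append, List.nil_append, List.cons.injEq] at h
          obtain ⟨rfl, rfl⟩ := h
          exact ⟨[], w, l, r, by simp, rfl, rfl⟩
        · simp only [Slice.crossings, List.cons_append, List.nil_append, List.cons.injEq] at h
          obtain ⟨rfl, h⟩ := h
          obtain ⟨w₁, w₂, l', r', rfl, rfl, rfl⟩ := ih h
          exact ⟨⟨l, .cross d, r⟩ :: w₁, w₂, l', r', by simp, by simp [crossings, Slice.crossings], rfl⟩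

/-! ## Moves and strategies -/

theorem Move.crossings_eq {P Q : Pseudodiagram} (h : Move P Q) :
    shape Q.word = shape P.word ∧ ∃ u v s, crossings P.word = u ++ none :: v ∧
      crossings Q.word = u ++ some s :: v := by
  obtain ⟨u, v, l, r, s, hP, hQ⟩ := h
  rw [hP, hQ]
  refine ⟨by simp [shape, Slice.map, Piece.map], crossings u, crossings v, s, ?_, ?_⟩ <;>
    simp [crossings, Slice.crossings]

theorem exists_move {P : Pseudodiagram} {u v : List (Option Slope)}
    (h : crossings P.word = u ++ none :: v) (s : Slope) :
    ∃ Q, Move P Q ∧ shape Q.word = shape P.word ∧ crossings Q.word = u ++ some s :: v := by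
  obtain ⟨w₁, w₂, l, r, hw, rfl, rfl⟩ := exists_of_crossings_eq h
  have hs : shape (w₁ ++ [⟨l, .cross (some s), r⟩] ++ w₂) = shape P.word := by
    rw [hw]
    simp [shape, Slice.map, Piece.map]
  exact ⟨⟨_, isTangle_shape.1 (hs ▸ isTangle_shape.2 P.closed)⟩, ⟨w₁, w₂, l, r, s, hw, rfl⟩, hs,
    by simp [crossings, Slice.crossings]⟩

theorem shape_of_reflTransGen {P Q : Pseudodiagram} (h : Relation.ReflTransGen Move P Q) :
    shape Q.word = shape P.word := by
  induction h with
  | refl => rfl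
  | tail _ h ih => exact h.crossings_eq.1.trans ih

theorem Diagram.ext {C : Type} {D E : Diagram C} (h : D.word = E.word) : D = E := by
  cases D; cases E; cases h; rfl

theorem IsOver.exists_linkDiagram {P : Pseudodiagram} (h : IsOver P) :
    ∃ D : LinkDiagram, D.toPseudo = P ∧ shape D.word = shape P.word ∧
      crossings P.word = (crossings D.word).map some := by
  have hn : none ∉ crossings P.word := fun hn => by
    obtain ⟨u, v, huv⟩ := List.append_of_mem hn
    obtain ⟨Q, hQ, -⟩ := exists_move huv .pos
    exact h Q hQ
  -- The default slope `.pos` is never used, since no crossing is unresolved.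
  have hc : crossings P.word =
      (crossings (Diagram.map (fun o : Option Slope => o.getD .pos) P).word).map some := by
    simp only [Diagram.map, crossings_map, List.map_map]
    refine ((List.map_congr_left fun o ho => ?_).trans (List.map_id _)).symm
    obtain _ | s := o
    · exact absurd ho hn
    · rfl
  refine ⟨Diagram.map (fun o => o.getD .pos) P, Diagram.ext (word_ext ?_ ?_), ?_, hc⟩
  · simp only [LinkDiagram.toPseudo, Diagram.map, shape_map]
  · rw [hc]
    simp only [LinkDiagram.toPseudo, Diagram.map, crossings_map]
  · simp only [Diagram.map, shape_map]

theorem Player.other_ne (p : Player) : p.other ≠ p := by cases p <;> simp [Player.other]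

/-- The second player wins if he can always restore an invariant that makes him win at the
end. -/
theorem hasWinningStrategy_of_invariant {p : Player} {P₀ : Pseudodiagram}
    (I : Pseudodiagram → Prop) (h₀ : I P₀)
    (hI : ∀ P Q, I P → Move P Q → ∃ R, Move Q R ∧ I R)
    (hW : ∀ P, I P → IsOver P → p.WinsAt P) : HasWinningStrategy p p.other P₀ := by
  classical
  -- The strategy restores the invariant where possible and otherwise plays any legal move; in
  -- finished positions its value is irrelevant.
  have hσ : ∀ P, ∃ R, (¬ IsOver P → Move P R) ∧ ((∃ R, Move P R ∧ I R) → Move P R ∧ I R) := by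
    intro P
    by_cases h : ∃ R, Move P R ∧ I R
    · obtain ⟨R, hR⟩ := h
      exact ⟨R, fun _ => hR.1, fun _ => hR⟩
    · by_cases h' : IsOver P
      · exact ⟨P, fun h => absurd h' h, fun h' => absurd h' h⟩
      · obtain ⟨R, hR⟩ := not_forall_not.1 h'
        exact ⟨R, fun _ => hR, fun h' => absurd h' h⟩
  choose σ h₁ h₂ using hσ
  refine ⟨σ, h₁, fun q P hP => ?_⟩
  -- Before each move of the opponent the invariant holds, and before each own move some reply
  -- restores it. In particular the game cannot end on the turn of `p`.
  have key : (q = p.other → I P) ∧ (q = p → ∃ R, Move P R ∧ I R) := by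
    induction hP with
    | start => exact ⟨fun _ => h₀, fun h => absurd h p.other_ne⟩
    | own _ _ ih => exact ⟨fun _ => (h₂ _ (ih.2 rfl)).2, fun h => absurd h p.other_ne⟩
    | opponent _ hm ih => exact ⟨fun h => absurd h.symm p.other_ne, fun _ => hI _ _ (ih.1 rfl) hm⟩
  intro hover
  by_cases hq : q = p
  · obtain ⟨R, hR, -⟩ := key.2 hq
    exact absurd hR (hover R)
  · refine hW P (key.1 ?_) hover
    revert hq
    cases q <;> cases p <;> simp [Player.other]

/-! ## Rational tangles as sequences of twists -/

/-- The twists of a tangle word: `true` stands for a bottom twist, `false` for a right twist. -/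
def twistList : Bool → List ℤ → List (Bool × Slope)
  | _, [] => []
  | b, a :: as => List.replicate a.natAbs (b, syllableSlope a) ++ twistList (!b) as

/-- Perform one twist. -/
def twist (T : Word Slope) (t : Bool × Slope) : Word Slope :=
  if t.1 then twistBottom t.2 T else twistRight t.2 T

theorem foldl_twist_replicate (T : Word Slope) (b : Bool) (s : Slope) (n : ℕ) :
    (List.replicate n (b, s)).foldl twist T =
      (if b then twistBottom s else twistRight s)^[n] T := by
  induction n generalizing T with
  | zero => rfl
  | succ n ih =>
    rw [List.replicate_succ, List.foldl_cons, ih, Function.iterate_succ_apply]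
    cases b <;> rfl

theorem addSyllables_eq (b : Bool) (T : Word Slope) (a : List ℤ) :
    addSyllables b T a = (twistList b a).foldl twist T := by
  induction a generalizing b T with
  | nil => cases b <;> rfl
  | cons x a ih =>
    rw [twistList, List.foldl_append, foldl_twist_replicate]
    cases b
    · exact ih _ _
    · exact ih _ _

theorem shape_foldl_twist {l l' : List (Bool × Slope)} {T T' : Word Slope}
    (h : l.map Prod.fst = l'.map Prod.fst) (hT : shape T = shape T') :
    shape (l.foldl twist T) = shape (l'.foldl twist T') := by
  induction l generalizing l' T T' with
  | nil =>
    obtain _ | ⟨t, l'⟩ := l'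
    · exact hT
    · simp at h
  | cons t l ih =>
    obtain _ | ⟨t', l'⟩ := l'
    · simp at h
    · simp only [List.map_cons, List.cons.injEq] at h
      refine ih (l' := l') h.2 ?_
      obtain ⟨b, s⟩ := t
      obtain ⟨b', s'⟩ := t'
      obtain rfl : b = b' := h.1
      cases b
      · simp only [twist, twistRight, shape_append, shape_whisker, hT, Bool.false_eq_true, if_false]
        rfl
      · simp only [twist, twistBottom, shape_append, hT, if_true]
        rfl

theorem crossings_foldl_twist (l : List (Bool × Slope)) (T : Word Slope) :
    crossings (l.foldl twist T) = crossings T ++ l.map Prod.snd := by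
  induction l generalizing T with
  | nil => simp
  | cons t l ih =>
    rw [List.foldl_cons, ih]
    obtain ⟨b, s⟩ := t
    cases b
    · simp only [twist, twistRight, crossings_append, crossings_whisker, Bool.false_eq_true,
        if_false]
      simp [crossings, Slice.crossings]
    · simp only [twist, twistBottom, crossings_append, if_true]
      simp [crossings, Slice.crossings]

theorem shape_closeWord {T T' : Word Slope} (h : shape T = shape T') (c : Closure) :
    shape (closeWord c T) = shape (closeWord c T') := by
  cases c <;> simp only [closeWord, shape_append, shape_whisker, h]

theorem crossings_closeWord (T : Word Slope) (c : Closure) :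
    crossings (closeWord c T) = crossings T := by
  cases c <;> simp only [closeWord, crossings_append, crossings_whisker] <;>
    simp [crossings, Slice.crossings]

theorem crossings_shadow (D : LinkDiagram) :
    crossings D.shadow.word = List.replicate (crossings D.word).length none := by
  simp [LinkDiagram.shadow, Diagram.map, crossings_map, List.map_const']

theorem shape_shadow (D : LinkDiagram) : shape D.shadow.word = shape D.word := by
  simp only [LinkDiagram.shadow, Diagram.map, shape_map]

theorem crossings_rationalLink (c : Closure) (a : List ℤ) :
    crossings (rationalLink c a).word = (twistList true a).map Prod.snd := by
  simp only [rationalLink, rationalTangle, addSyllables_eq, crossings_closeWord,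
    crossings_foldl_twist]
  rfl

/-- A diagram of the shape of a rational link is obtained by the same twists in other
directions. -/
theorem word_eq_of_shape {c : Closure} {a : List ℤ} {D : LinkDiagram}
    (hD : shape D.word = shape (rationalLink c a).word) {l : List (Bool × Slope)}
    (h₁ : l.map Prod.fst = (twistList true a).map Prod.fst)
    (h₂ : l.map Prod.snd = crossings D.word) : D.word = closeWord c (l.foldl twist []) := by
  apply word_ext
  · rw [hD]
    simp only [rationalLink, rationalTangle, addSyllables_eq]
    exact shape_closeWord (shape_foldl_twist h₁.symm rfl) c
  · rw [crossings_closeWord, crossings_foldl_twist, h₂]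
    rfl

theorem exists_twists_of_shape {c : Closure} {a : List ℤ} {D : LinkDiagram}
    (hD : shape D.word = shape (rationalLink c a).word) :
    ∃ l : List (Bool × Slope), l.map Prod.fst = (twistList true a).map Prod.fst ∧
      l.map Prod.snd = crossings D.word := by
  have h := length_crossings hD
  rw [crossings_rationalLink, List.length_map] at h
  exact ⟨((twistList true a).map Prod.fst).zip (crossings D.word),
    List.map_fst_zip (by simp [h]), List.map_snd_zip (by simp [h])⟩

/-- Each right twist around a tangle that is already trivial can be undone, so the inner twists are
removed first. -/
theorem reduces_foldl_right {l : List (Bool × Slope)} (h : ∀ b ∈ l.map Prod.fst, b = false)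
    {T : Word Slope} (hT : Reduces T []) : Reduces (l.foldl twist T) [] := by
  induction l generalizing T with
  | nil => exact hT
  | cons t l ih =>
    simp only [List.map_cons, List.mem_cons, forall_eq_or_imp] at h
    refine ih h.2 ?_
    simp only [twist, h.1, Bool.false_eq_true, if_false]
    exact hT.twistRight_nil _

/-- Each twist together with its inverse. -/
def cancellingTwists (l : List (Bool × Slope)) : List (Bool × Slope) :=
  l.flatMap fun t => [t, (t.1, t.2.opp)]

theorem reduces_foldl_cancellingTwists (l : List (Bool × Slope)) {T : Word Slope}
    (hT : Reduces T []) : Reduces ((cancellingTwists l).foldl twist T) [] := by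
  induction l generalizing T with
  | nil => exact hT
  | cons t l ih =>
    refine ih (T := twist (twist T t) (t.1, t.2.opp)) ?_
    obtain ⟨b, s⟩ := t
    cases b
    · exact (hT.twistRight_nil _).twistRight_nil _
    · exact hT.twistBottom_twistBottom_nil _

/-- Repeat each entry of a list. -/
def double {α : Type} (l : List α) : List α := l.flatMap fun x => [x, x]

/-- The contribution of a twist to the linking number modulo two. -/
def twistWeight (t : Bool × Slope) : ZMod 2 := if t.1 then t.2.weight else 0

/-- Each bottom pair adds `1` plus its two weights to the index. Collecting the ones into `bs.count
true` leaves a sum over single crossings, in which every bottom crossing can toggle the parity by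
itself. -/
theorem IsVertical.foldl {bs : List Bool} {l : List (Bool × Slope)}
    (hl : l.map Prod.fst = double bs) {T : Word Slope} {e : ZMod 2} (hT : IsVertical T e) :
    IsVertical (l.foldl twist T) (e + ((bs.count true : ℕ) + (l.map twistWeight).sum)) := by
  induction bs generalizing l T e with
  | nil =>
    obtain rfl : l = [] := by simpa [double] using hl
    simpa using hT
  | cons b bs ih =>
    obtain _ | ⟨⟨b₁, s⟩, _ | ⟨⟨b₂, t⟩, l⟩⟩ := l
    · simp [double] at hl
    · simp [double] at hl
    · simp only [double, List.map_cons, List.flatMap_cons, List.cons_append, List.nil_append,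
        List.cons.injEq] at hl
      obtain ⟨rfl, rfl, hl⟩ := hl
      cases b₂
      · have := ih hl ((hT.right s).right t)
        simpa [twistWeight, twist] using this
      · have := ih hl (hT.bottom s t)
        simp only [List.foldl_cons, List.map_cons, List.sum_cons, List.count_cons_self,
          twistWeight, if_true]
        have e' : e + (((bs.count true + 1 : ℕ) : ZMod 2) +
            (s.weight + (t.weight + (l.map twistWeight).sum))) =
            e + (1 + s.weight + t.weight) +
              (((bs.count true : ℕ) : ZMod 2) + (l.map twistWeight).sum) := by
          push_cast
          ring
        rw [e']
        exact this

theorem exists_double_of_even {b : Bool} {a : List ℤ} (h : ∀ x ∈ a, Even x) :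
    ∃ bs, (twistList b a).map Prod.fst = double bs := by
  induction a generalizing b with
  | nil => exact ⟨[], rfl⟩
  | cons x a ih =>
    simp only [List.mem_cons, forall_eq_or_imp] at h
    obtain ⟨n, hn⟩ := Int.natAbs_even.2 h.1
    obtain ⟨bs, hbs⟩ := ih (b := !b) h.2
    refine ⟨List.replicate n b ++ bs, ?_⟩
    have : ∀ n, List.replicate (n + n) b = double (List.replicate n b) := fun n => by
      induction n with
      | zero => rfl
      | succ n ih =>
        rw [show n + 1 + (n + 1) = n + n + 1 + 1 by ring, List.replicate_succ, List.replicate_succ,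
          ih, List.replicate_succ]
        rfl
    simp only [twistList, List.map_append, List.map_replicate, hn, this, hbs]
    simp [double]

/-- The offset `if b then 0 else 1` locates the bottom syllables in a list that starts with a bottom
or with a right syllable. As zero is even, vanishing bottom syllables also give a vertical tangle.
-/
theorem not_bottom_of_zero {b : Bool} {a : List ℤ}
    (h : ∀ k (hk : 2 * k + (if b then 0 else 1) < a.length),
      a[2 * k + (if b then 0 else 1)] = 0) :
    (∀ x ∈ (twistList b a).map Prod.fst, x = false) ∧ BottomEven b a := by
  induction a generalizing b with
  | nil => exact ⟨by simp [twistList], by cases b <;> trivial⟩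
  | cons y a ih =>
    cases b
    · have := ih (b := true) fun k hk => by simpa using h k (by simpa using hk)
      refine ⟨fun x hx => ?_, this.2⟩
      simp only [twistList, List.map_append, List.map_replicate, List.mem_append] at hx
      exact hx.elim List.eq_of_mem_replicate (this.1 x)
    · obtain rfl : y = 0 := by simpa using h 0 (by simp)
      have := ih (b := false) fun k hk => by
        simpa [mul_add] using h (k + 1) (by simp at hk ⊢; omega)
      exact ⟨by simpa [twistList] using this.1, Even.zero, this.2⟩

theorem exists_bottom_of_ne_zero {b : Bool} {a : List ℤ}
    (h : ∃ k, ∃ hk : 2 * k + (if b then 0 else 1) < a.length,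
      a[2 * k + (if b then 0 else 1)] ≠ 0) : true ∈ (twistList b a).map Prod.fst := by
  induction a generalizing b with
  | nil => obtain ⟨k, hk, -⟩ := h; simp at hk
  | cons y a ih =>
    obtain ⟨k, hk, h⟩ := h
    simp only [twistList, List.map_append, List.map_replicate, List.mem_append]
    cases b
    · exact Or.inr (ih (b := true) ⟨k, by simpa using hk, by simpa using h⟩)
    · obtain _ | k := k
      · exact Or.inl (by simpa using h)
      · exact Or.inr (ih (b := false) ⟨k, by simp at hk ⊢; omega, by simpa [mul_add] using h⟩)

/-! ## The strategies -/

/-- A two-component diagram has a colouring with both colours, whereas the numerator closure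
connects both strands of a vertical tangle. -/
theorem shadow_denominator {a : List ℤ} {c : Closure}
    (htwo : (rationalLink c a).shadow.numComponents = 2) (ha : BottomEven true a) :
    c = .denominator := by
  cases c
  · obtain ⟨e, he⟩ := IsVertical.nil.addSyllables ha
    obtain ⟨f, g, p, S, h, hS⟩ := LinkDiagram.exists_coloured_of_numComponents htwo
    exact (he.not_coloured_numerator h hS).elim
  · rfl

theorem alwaysWins_unlinker {a : List ℤ}
    (ha : ∀ b ∈ (twistList true a).map Prod.fst, b = false) :
    AlwaysWins .unlinker (rationalLink .denominator a).shadow := by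
  intro P hP hover
  obtain ⟨D, hDP, hD, -⟩ := hover.exists_linkDiagram
  have hs : shape D.word = shape (rationalLink .denominator a).word := by
    rw [hD, shape_of_reflTransGen hP, shape_shadow]
  obtain ⟨l, h₁, h₂⟩ := exists_twists_of_shape hs
  exact ⟨D, hDP, Reduces.splittable (reduces_foldl_right (h₁ ▸ ha) .refl)
    (word_eq_of_shape hs h₁ h₂)⟩

/-- The crossings of pairs of twists, the second one of each pair being opposite to the first. -/
def oppositePairs (l : List (Option Slope)) : List (Option Slope) :=
  l.flatMap fun o => [o, o.map Slope.opp]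

theorem oppositePairs_append_cons (l l' : List (Option Slope)) (o : Option Slope) :
    oppositePairs (l ++ o :: l') =
      oppositePairs l ++ o :: o.map Slope.opp :: oppositePairs l' := by
  simp [oppositePairs]

/-- In such a list the two members of a pair are resolved or unresolved together, so an unresolved
crossing, first or second in its pair, still has its partner available. -/
theorem oppositePairs_eq_append {l u v : List (Option Slope)}
    (h : oppositePairs l = u ++ none :: v) :
    ∃ l₁ l₂, l = l₁ ++ none :: l₂ ∧ ((u = oppositePairs l₁ ∧ v = none :: oppositePairs l₂) ∨
      (u = oppositePairs l₁ ++ [none] ∧ v = oppositePairs l₂)) := by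
  induction l generalizing u with
  | nil => simp [oppositePairs] at h
  | cons o l ih =>
    have e : oppositePairs (o :: l) = o :: o.map Slope.opp :: oppositePairs l := by
      simp [oppositePairs]
    rw [e] at h
    obtain _ | ⟨x, _ | ⟨y, u⟩⟩ := u
    · simp only [List.nil_append, List.cons.injEq] at h
      obtain ⟨rfl, rfl⟩ := h
      exact ⟨[], l, rfl, Or.inl ⟨rfl, rfl⟩⟩
    · simp only [List.cons_append, List.nil_append, List.cons.injEq, Option.map_eq_none_iff] at h
      obtain ⟨rfl, rfl, rfl⟩ := h
      exact ⟨[], l, rfl, Or.inr ⟨rfl, rfl⟩⟩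
    · simp only [List.cons_append, List.cons.injEq] at h
      obtain ⟨rfl, rfl, h⟩ := h
      obtain ⟨l₁, l₂, rfl, h'⟩ := ih h
      refine ⟨o :: l₁, l₂, rfl, ?_⟩
      rcases h' with ⟨hu, hv⟩ | ⟨hu, hv⟩
      · exact Or.inl ⟨by rw [hu]; simp [oppositePairs], hv⟩
      · exact Or.inr ⟨by rw [hu]; simp [oppositePairs], hv⟩

/-- The invariant is that every pair is either untouched or resolved with opposite slopes. The reply
completes the pair just touched, and at the end every pair is a twist followed by its inverse. -/
theorem hasWinningStrategy_unlinker {a : List ℤ} {bs : List Bool}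
    (hbs : (twistList true a).map Prod.fst = double bs) :
    HasWinningStrategy .unlinker (Player.other .unlinker)
      (rationalLink .denominator a).shadow := by
  have hlen : ((twistList true a).map Prod.snd).length = 2 * bs.length := by
    rw [List.length_map, ← List.length_map (f := Prod.fst), hbs]
    simp [double, List.length_flatMap, mul_comm]
  apply hasWinningStrategy_of_invariant fun P =>
    shape P.word = shape (rationalLink .denominator a).word ∧
      ∃ l, crossings P.word = oppositePairs l ∧ l.length = bs.length
  · refine ⟨shape_shadow _, List.replicate bs.length none, ?_, by simp⟩
    rw [crossings_shadow, crossings_rationalLink, hlen]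
    generalize bs.length = n
    induction n with
    | zero => rfl
    | succ n ih =>
      rw [mul_add, List.replicate_succ (n := n), ← List.nil_append (none :: List.replicate n none),
        oppositePairs_append_cons, ← ih]
      rfl
  · rintro P Q ⟨hP, l, hl, hn⟩ hPQ
    obtain ⟨hs, u, v, s, hu, hv⟩ := hPQ.crossings_eq
    obtain ⟨l₁, l₂, rfl, ⟨rfl, rfl⟩ | ⟨rfl, rfl⟩⟩ := oppositePairs_eq_append (hl.symm.trans hu)
    · rw [List.append_cons] at hv
      obtain ⟨R, hR, hRs, hRc⟩ := exists_move hv s.opp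
      refine ⟨R, hR, hRs.trans (hs.trans hP), l₁ ++ some s :: l₂, ?_, by simpa using hn⟩
      rw [hRc, oppositePairs_append_cons]
      simp
    · rw [List.append_assoc] at hv
      obtain ⟨R, hR, hRs, hRc⟩ := exists_move hv s.opp
      refine ⟨R, hR, hRs.trans (hs.trans hP), l₁ ++ some s.opp :: l₂, ?_, by simpa using hn⟩
      rw [hRc, oppositePairs_append_cons]
      simp [Slope.opp_opp]
  · rintro P ⟨hP, l, hl, hn⟩ hover
    obtain ⟨D, hDP, hD, hc⟩ := hover.exists_linkDiagram
    -- No entry of `l` is `none`, because each occurs among the resolved crossings; the default is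
    -- again never used.
    obtain ⟨l, rfl⟩ : ∃ l' : List Slope, l = l'.map some := by
      refine ⟨l.map fun o => o.getD .pos, ?_⟩
      rw [List.map_map]
      refine ((List.map_congr_left fun o ho => ?_).trans (List.map_id _)).symm
      have ho' : o ∈ crossings P.word := by
        rw [hl, oppositePairs, List.mem_flatMap]
        exact ⟨o, ho, by simp⟩
      rw [hc, List.mem_map] at ho'
      obtain ⟨s, -, rfl⟩ := ho'
      rfl
    have hDc : crossings D.word = l.flatMap fun s => [s, s.opp] := by
      apply List.map_injective_iff.2 (Option.some_injective _)
      rw [← hc, hl, oppositePairs, List.flatMap_map, List.map_flatMap]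
      rfl
    rw [List.length_map] at hn
    refine ⟨D, hDP, Reduces.splittable (reduces_foldl_cancellingTwists (bs.zip l) .refl)
      (word_eq_of_shape (hD.trans hP) ?_ ?_)⟩
    · rw [hbs, cancellingTwists, List.map_flatMap]
      conv_rhs => rw [← List.map_fst_zip hn.ge, double, List.flatMap_map]
      rfl
    · rw [hDc, cancellingTwists, List.map_flatMap]
      conv_rhs => rw [← List.map_snd_zip hn.le, List.flatMap_map]
      rfl

instance : DecidableEq Slope
  | .pos, .pos => isTrue rfl
  | .neg, .neg => isTrue rfl
  | .pos, .neg => isFalse nofun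
  | .neg, .pos => isFalse nofun

/-- The contribution of a twist, that has possibly not yet been performed, to the linking number
modulo two. -/
def pendingWeight (t : Bool × Option Slope) : ZMod 2 :=
  match t with
  | (true, some s) => s.weight
  | _ => 0

/-- The invariant keeps the number of unresolved crossings of each kind even and, once the bottom
crossings are exhausted, makes the index odd. Pairs do not matter for the replies, only the kind of
the crossing does. -/
theorem hasWinningStrategy_linker {a : List ℤ} {bs : List Bool}
    (hbs : (twistList true a).map Prod.fst = double bs)
    (hb : true ∈ (twistList true a).map Prod.fst) :
    HasWinningStrategy .linker (Player.other .linker) (rationalLink .denominator a).shadow := by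
  apply hasWinningStrategy_of_invariant fun P =>
    shape P.word = shape (rationalLink .denominator a).word ∧
      ∃ l : List (Bool × Option Slope), crossings P.word = l.map Prod.snd ∧
        l.map Prod.fst = double bs ∧ (∀ b, Even (l.count (b, none))) ∧
        (l.count (true, none) = 0 → ((bs.count true : ℕ) : ZMod 2) + (l.map pendingWeight).sum = 1)
  · have hcount : ∀ b, ((double bs).map fun b => (b, (none : Option Slope))).count (b, none) =
        2 * bs.count b := by
      intro b
      clear hbs
      induction bs with
      | nil => rfl
      | cons b' bs ih =>
        have e : double (b' :: bs) = b' :: b' :: double bs := by simp [double]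
        rw [e]
        simp only [List.map_cons, List.count_cons, ih, Prod.mk.injEq, beq_iff_eq]
        by_cases h : b' = b <;> simp [h]; ring
    refine ⟨shape_shadow _, (double bs).map fun b => (b, none), ?_, ?_, ?_, ?_⟩
    · rw [crossings_shadow, crossings_rationalLink, List.length_map, List.map_map,
        ← List.length_map (f := Prod.fst), hbs]
      simp [Function.comp_def, List.map_const']
    · simp [Function.comp_def]
    · intro b
      rw [hcount]
      simp
    -- At the start the last clause is vacuous: some bottom crossing exists and is unresolved.
    · intro h
      rw [hcount] at h
      rw [hbs, double, List.mem_flatMap] at hb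
      obtain ⟨b, hb, hb'⟩ := hb
      obtain rfl : true = b := by simpa using hb'
      have := List.count_pos_iff.2 hb
      omega
  · rintro P Q ⟨hP, l, hl, hf, he, hw⟩ hPQ
    obtain ⟨hs, u, v, s, hu, hv⟩ := hPQ.crossings_eq
    obtain ⟨l₁, l₂', rfl, rfl, h⟩ := List.map_eq_append_iff.1 (hl.symm.trans hu)
    obtain ⟨⟨b, o⟩, l₂, rfl, rfl, rfl⟩ := List.map_eq_cons_iff.1 h
    -- The opponent has left an odd number of unresolved crossings of the kind just played, so at
    -- least one is available for the reply.
    have hcard : Odd ((l₁ ++ (b, some s) :: l₂).count (b, none)) := by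
      have := he b
      simp only [List.count_append, List.count_cons_self, ← add_assoc] at this
      rw [Nat.even_add_one, Nat.not_even_iff_odd] at this
      simpa [List.count_append, List.count_cons] using this
    obtain ⟨l₃, l₄, h₃⟩ := List.append_of_mem (List.count_pos_iff.1 hcard.pos)
    have hQ : crossings Q.word = l₃.map Prod.snd ++ none :: l₄.map Prod.snd := by
      have := congrArg (List.map Prod.snd) h₃
      rw [hv]
      simpa using this
    -- At a bottom crossing, `t` makes the sum equal to one with the pending crossings counted as
    -- zero. This matters only when none is pending, but doing it every time avoids a case
    -- distinction.
    obtain ⟨t, ht⟩ : ∃ t : Slope, b = true → ((bs.count true : ℕ) : ZMod 2) +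
        ((l₃ ++ (b, some t) :: l₄).map pendingWeight).sum = 1 := by
      by_cases hb : b = true
      · subst hb
        have e : ∀ t : Slope, ((bs.count true : ℕ) : ZMod 2) +
            ((l₃ ++ (true, some t) :: l₄).map pendingWeight).sum = t.weight +
              (((bs.count true : ℕ) : ZMod 2) + (l₃.map pendingWeight).sum +
                (l₄.map pendingWeight).sum) := fun t => by
          simp only [List.map_append, List.map_cons, List.sum_append, List.sum_cons, pendingWeight]
          ring
        simp only [e, forall_const]
        generalize ((bs.count true : ℕ) : ZMod 2) + (l₃.map pendingWeight).sum +
                (l₄.map pendingWeight).sum = z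
        have : ∀ z : ZMod 2, z = 0 ∨ z = 1 := by decide
        rcases this z with rfl | rfl
        · exact ⟨.neg, rfl⟩
        · exact ⟨.pos, rfl⟩
      · exact ⟨.pos, fun h => absurd h hb⟩
    obtain ⟨R, hR, hRs, hRc⟩ := exists_move hQ t
    refine ⟨R, hR, hRs.trans (hs.trans hP), l₃ ++ (b, some t) :: l₄, by simp [hRc], ?_, ?_, ?_⟩
    · have := congrArg (List.map Prod.fst) h₃
      rw [← hf]
      simpa using this.symm
    · intro b'
      by_cases hbb : b' = b
      · subst hbb
        rw [h₃] at hcard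
        simp only [List.count_append, List.count_cons_self, ← add_assoc] at hcard
        rw [Nat.odd_add_one, Nat.not_odd_iff_even] at hcard
        simpa [List.count_append, List.count_cons] using hcard
      · have h1 := he b'
        have h2 := congrArg (List.count (b', none)) h₃
        simp only [List.count_append, List.count_cons, beq_iff_eq, Prod.mk.injEq, reduceCtorEq,
          and_false, if_false, Ne.symm hbb, false_and, add_zero] at h1 h2 ⊢
        rwa [← h2]
    · intro h0
      by_cases hb : b = true
      · exact ht hb
      -- A round of right twists changes neither the pending bottom crossings nor the sum of
      -- weights.
      · obtain rfl : b = false := by simpa using hb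
        have h2 := congrArg (List.count (true, none)) h₃
        have h3 := congrArg (fun l => (l.map pendingWeight).sum) h₃
        simp only [List.count_append, List.count_cons, beq_iff_eq, Prod.mk.injEq, reduceCtorEq,
          and_false, false_and, if_false, add_zero, List.map_append, List.map_cons,
          List.sum_append, List.sum_cons, pendingWeight, zero_add] at h0 h2 h3 hw ⊢
        rw [← h3]
        exact hw (h2.trans h0)
  · rintro P ⟨hP, l, hl, hf, he, hw⟩ hover
    obtain ⟨D, hDP, hD, hc⟩ := hover.exists_linkDiagram
    obtain ⟨l', h₁, h₂⟩ := exists_twists_of_shape (hD.trans hP)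
    have hll : l = l'.map fun t => (t.1, some t.2) := by
      rw [List.zip_of_prod hf (hl.symm.trans hc)]
      symm
      apply List.zip_of_prod
      · rw [List.map_map, ← hbs, ← h₁]
        rfl
      · rw [List.map_map, ← h₂, List.map_map]
        rfl
    -- All crossings are resolved now, so the last clause of the invariant applies and yields index
    -- one.
    have hw := hw (by rw [hll]; simp [List.count_eq_zero])
    have hv := IsVertical.nil.foldl (h₁.trans hbs)
    have e : (l.map pendingWeight).sum = (l'.map twistWeight).sum := by
      rw [hll, List.map_map]
      congr 2
      funext ⟨b, s⟩
      cases b <;> rfl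
    rw [zero_add, ← e, hw] at hv
    exact ⟨D, hDP, (hv.oddlyLinked (word_eq_of_shape (hD.trans hP) h₁ h₂)).not_splittable⟩

end LinkGame

theorem theorem4p1 (a : List ℤ) (c : LinkGame.Closure)
    (htwo : (LinkGame.rationalLink c a).shadow.numComponents = 2) :
    ((∀ (k : ℕ) (hk : 2 * k < a.length), a[2 * k] = 0) →
      LinkGame.AlwaysWins .unlinker (LinkGame.rationalLink c a).shadow) ∧
    ((∃ (k : ℕ) (hk : 2 * k < a.length), a[2 * k] ≠ 0) → (∀ x ∈ a, Even x) →
      LinkGame.SecondPlayerWins (LinkGame.rationalLink c a).shadow) := by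
  open LinkGame in
  refine ⟨fun h => ?_, fun h heven p => ?_⟩
  · obtain ⟨hb, he⟩ := not_bottom_of_zero (b := true) (by simpa using h)
    obtain rfl := shadow_denominator htwo he
    exact alwaysWins_unlinker hb
  · obtain rfl := shadow_denominator htwo (BottomEven.of_forall_even heven)
    obtain ⟨bs, hbs⟩ := exists_double_of_even (b := true) heven
    cases p
    · exact hasWinningStrategy_linker hbs (exists_bottom_of_ne_zero (by simpa using h))
    · exact hasWinningStrategy_unlinker hbs
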